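/- Let $D_1,D_2\subset\mathbb R$ be nondegenerate intervals containing $0$, let $\alpha:D_1\to\mathbb R$ and $\beta:D_2\to\mathbb R$ be smooth functions with $\alpha(0)=0$, and let $D=D_1\times D_2$. (At an endpoint belonging to an interval, derivatives are one-sided.) Notation. A loop is a map $g:\mathbb R^*\to SU(2)$, $\lambda\mapsto g(\lambda)$; loops are multiplied pointwise in $\lambda$. Let $\widetilde\Lambda SU(2)$ be the set of loops that satisfy $g(-\lambda)=\sigma_3\,g(\lambda)\,\sigma_3^{-1}$, $\sigma_3=\mathrm{diag}(1,-1)$, and extend analytically to $\lambda\in\mathbb C^*$. Let $\Lambda^{+}SU(2)$ (resp. $\Lambda^-SU(2)$) be the set of those $g\in\widetilde\Lambda SU(2)$ that have an expansion $g=g_0+\lambda g_1+\lambda^2g_2+\cdots$ (resp. $g=g_0+\lambda^{-1}g_1+\lambda^{-2}g_2+\cdots$), convergent for all $\lambda\in\mathbb R^*$, and let $\Lambda^\pm_*SU(2)\subset\Lambda^\pm SU(2)$ be the subsets given by $g_0=I$. Put $$V_{-0}(x)=\begin{bmatrix}e^{-\mathrm i\alpha(x)/2}&0\\0&e^{\mathrm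 i\alpha(x)/2}\end{bmatrix},\quad \eta_+^X(x,\lambda)=\frac{\mathrm i}{2}\lambda\begin{bmatrix}0&e^{-\mathrm i\alpha(x)}\\e^{\mathrm i\alpha(x)}&0\end{bmatrix},\quad \eta_-^Y(y,\lambda)=-\frac{\mathrm i}{2\lambda}\begin{bmatrix}0&e^{\mathrm i\beta(y)}\\e^{-\mathrm i\beta(y)}&0\end{bmatrix}.$$ Theorem. There are loop-valued maps $U^X_+(x)$ on $D_1$ and $U^Y_-(y)$ on $D_2$ with $$(U^X_+)^{-1}\frac{\partial U^X_+}{\partial x}=\eta^X_+,\qquad (U^Y_-)^{-1}\frac{\partial U^Y_-}{\partial y}=\eta^Y_-,\qquad U^X_+(0)=U^Y_-(0)=I$$ for all $\lambda\in\mathbb R^*$. Any such maps take values in $\Lambda^+_*SU(2)$ and $\Lambda^-_*SU(2)$ respectively, and for every $(x,y)\in D$ there is exactly one Birkhoff decomposition $$(U^Y_-)^{-1}U^X_+V_{-0}=V_+(T_-)^{-1},\qquad V_+(x,y)\in\Lambda^+SU(2),\quad T_-(x,y)\in\Lambda^-_*SU(2).$$ For each $\lambda$, the maps $V_+$, $T_-$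 and $$U=U^X_+V_{-0}T_-=U^Y_-V_+$$ are smooth in $(x,y)\in D$. Moreover $U(0,0;\lambda)=I$ for all $\lambda\in\mathbb R^*$, and there is a smooth function $\phi:D\to\mathbb R$ such that, on $D$ and for all $\lambda\in\mathbb R^*$, $$\frac{\partial U}{\partial x}=\frac{\mathrm i}{2}U\begin{bmatrix}-\phi_x&\lambda\\\lambda&\phi_x\end{bmatrix},\qquad \frac{\partial U}{\partial y}=-\frac{\mathrm i}{2\lambda}U\begin{bmatrix}0&e^{\mathrm i\phi}\\e^{-\mathrm i\phi}&0\end{bmatrix},$$ and $\phi(x,0)=\alpha(x)+\beta(0)$ for $x\in D_1$, $\phi(0,y)=\beta(y)$ for $y\in D_2$. -/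

import Mathlib

open scoped ContDiff

noncomputable section

namespace PSLoop

/-- Complex `2 × 2` matrices. -/
abbrev Mat := Matrix (Fin 2) (Fin 2) ℂ

/-- The group `SU(2)`. -/
abbrev SU2 := Matrix.specialUnitaryGroup (Fin 2) ℂ

/-- Maps `ℝ^* → SU(2)`, with the pointwise group structure; `ℝˣ` is the set of nonzero reals. -/
abbrev Loop := ℝˣ → SU2

/-- A nonzero real parameter as a complex number. -/
abbrev toC (l : ℝˣ) : ℂ := ((l : ℝ) : ℂ)

/-- `σ₃ = diag(1, -1)`. -/
def sigma3 : Mat := !![1, 0; 0, -1]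

/-- The twisted loop group `Λ SU(2)`: loops with `g(-λ) = Ad(σ₃) g(λ)`. -/
def twistedLoops : Set Loop :=
  {g | ∀ l : ℝˣ, (g (-l) : Mat) = sigma3 * (g l : Mat) * sigma3⁻¹}

/-- The twisted loops that extend to `ℂ^*` as analytic functions of `λ`. -/
def analyticLoops : Set Loop :=
  {g | g ∈ twistedLoops ∧ ∃ G : ℂ → Mat,
    (∀ i j, DifferentiableOn ℂ (fun z => G z i j) {0}ᶜ) ∧ ∀ l : ℝˣ, G (toC l) = (g l : Mat)}

/-- `g = g₀ + λ g₁ + λ² g₂ + ⋯` with coefficient sequence `c`. -/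
def HasPosExpansion (g : Loop) (c : ℕ → Mat) : Prop :=
  ∀ l : ℝˣ, HasSum (fun k : ℕ => (toC l) ^ k • c k) (g l : Mat)

/-- `g = g₀ + λ⁻¹ g₁ + λ⁻² g₂ + ⋯` with coefficient sequence `c`. -/
def HasNegExpansion (g : Loop) (c : ℕ → Mat) : Prop :=
  ∀ l : ℝˣ, HasSum (fun k : ℕ => ((toC l)⁻¹) ^ k • c k) (g l : Mat)

/-- `Λ⁺ SU(2)`. -/
def loopsPlus : Set Loop := {g | g ∈ analyticLoops ∧ ∃ c, HasPosExpansion g c}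

/-- `Λ⁻ SU(2)`. -/
def loopsMinus : Set Loop := {g | g ∈ analyticLoops ∧ ∃ c, HasNegExpansion g c}

/-- `Λ⁺_* SU(2)`: the leading coefficient `g₀` is the identity. -/
def loopsPlusStar : Set Loop := {g | g ∈ analyticLoops ∧ ∃ c, HasPosExpansion g c ∧ c 0 = 1}

/-- `Λ⁻_* SU(2)`: the leading coefficient `g₀` is the identity. -/
def loopsMinusStar : Set Loop := {g | g ∈ analyticLoops ∧ ∃ c, HasNegExpansion g c ∧ c 0 = 1}

/-- `diag(e^{-it/2}, e^{it/2})`. -/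
def diagMat (t : ℝ) : Mat :=
  !![Complex.exp (-(Complex.I * t / 2)), 0; 0, Complex.exp (Complex.I * t / 2)]

theorem diagMat_mem (t : ℝ) : diagMat t ∈ Matrix.specialUnitaryGroup (Fin 2) ℂ := by
  rw [Matrix.mem_specialUnitaryGroup_iff, Matrix.mem_unitaryGroup_iff]
  constructor
  · ext i j
    fin_cases i <;> fin_cases j <;>
      simp [diagMat, Matrix.mul_apply, Fin.sum_univ_two, Matrix.star_apply, ← Complex.exp_conj,
        ← Complex.exp_add, neg_div, Complex.conj_ofNat]
  · simp [diagMat, Matrix.det_fin_two, ← Complex.exp_add]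

/-- The `λ`-independent loop `V_{-0}(x) = diag(e^{-iα(x)/2}, e^{iα(x)/2})`. -/
def Vzero (α : ℝ → ℝ) (x : ℝ) : Loop := fun _ => ⟨diagMat (α x), diagMat_mem (α x)⟩

/-- The normalized potential `η₊ = (i/2) λ [[0, e^{-iα(x)}], [e^{iα(x)}, 0]]`. -/
def etaPlus (α : ℝ → ℝ) (x : ℝ) (l : ℝˣ) : Mat :=
  (Complex.I / 2 * toC l) •
    !![0, Complex.exp (-(Complex.I * α x)); Complex.exp (Complex.I * α x), 0]

/-- The normalized potential `η₋ = -(i/(2λ)) [[0, e^{iβ(y)}], [e^{-iβ(y)}, 0]]`. -/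
def etaMinus (β : ℝ → ℝ) (y : ℝ) (l : ℝˣ) : Mat :=
  (-(Complex.I / (2 * toC l))) •
    !![0, Complex.exp (Complex.I * β y); Complex.exp (-(Complex.I * β y)), 0]

/-- The matrix function `F` has derivative `F'` at `t` within `S`, entry by entry. -/
def MatHasDerivWithinAt (F : ℝ → Mat) (F' : Mat) (S : Set ℝ) (t : ℝ) : Prop :=
  ∀ i j, HasDerivWithinAt (fun s => F s i j) (F' i j) S t

/-- `W(0) = I` and `W⁻¹ dW/dt = η(t)` on the interval `S`, for every `λ`. -/
def IntegratesPotential (η : ℝ → ℝˣ → Mat) (S : Set ℝ) (W : ℝ → Loop) : Prop :=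
  W 0 = 1 ∧ ∀ t ∈ S, ∀ l : ℝˣ,
    MatHasDerivWithinAt (fun s => (W s l : Mat)) ((W t l : Mat) * η t l) S t

/-- `(V, T)` is the Birkhoff decomposition `g = V T⁻¹`, `V ∈ Λ⁺ SU(2)`, `T ∈ Λ⁻_* SU(2)`. -/
def IsBirkhoff (g V T : Loop) : Prop :=
  V ∈ loopsPlus ∧ T ∈ loopsMinusStar ∧ g = V * T⁻¹

/-- A loop-valued map of `(x, y)` is smooth on `S`, for every `λ`. -/
def SmoothLoopMap (V : ℝ → ℝ → Loop) (S : Set (ℝ × ℝ)) : Prop :=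
  ∀ (l : ℝˣ) (i j : Fin 2), ContDiffOn ℝ ∞ (fun p : ℝ × ℝ => (V p.1 p.2 l : Mat) i j) S

/-- The Lax system for `U` with angle function `φ` on `D₁ × D₂`, for every `λ`:
`U_x = (i/2) U [[-φ_x, λ], [λ, φ_x]]` and `U_y = -(i/(2λ)) U [[0, e^{iφ}], [e^{-iφ}, 0]]`. -/
def LaxSystem (D₁ D₂ : Set ℝ) (U : ℝ → ℝ → Loop) (φ : ℝ → ℝ → ℝ) : Prop :=
  ∀ x ∈ D₁, ∀ y ∈ D₂, ∀ l : ℝˣ,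
    MatHasDerivWithinAt (fun s => (U s y l : Mat))
      ((Complex.I / 2) • ((U x y l : Mat) *
        !![-((derivWithin (fun s => φ s y) D₁ x : ℝ) : ℂ), toC l;
           toC l, ((derivWithin (fun s => φ s y) D₁ x : ℝ) : ℂ)])) D₁ x ∧
    MatHasDerivWithinAt (fun t => (U x t l : Mat))
      ((-(Complex.I / (2 * toC l))) • ((U x y l : Mat) *
        !![0, Complex.exp (Complex.I * φ x y); Complex.exp (-(Complex.I * φ x y)), 0])) D₂ y

end PSLoop

end

/-!
The theorem rests on the fact that every loop involved is the frame of a potential of one and the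
same shape. For a real function `θ` on an interval the equation `W' = z W N(θ)`, `W(0) = I`, with
`N(θ) = (i/2) [[0, e^{-iθ}], [e^{iθ}, 0]]`, is solved by a power series `W = ∑ zᵏ c_k` whose
coefficients are iterated integrals bounded by `|t|ᵏ / (2ᵏ k!)` (`hasSum_frame`,
`hasDerivWithinAt_frame`). It is entire in `z`, lies in `SU(2)` for real `z` because `N` is
skew-Hermitian and traceless, and is twisted because `σ₃ N σ₃ = -N`. With `z = λ`, `θ = α` this is
`U₊`; with `z = -1/λ`, `θ = -β` it is `U₋`.

The factorization is global because the sine-Gordon equation `φ_xy = sin φ` with data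
`φ(x, 0) = α(x) + β(0)`, `φ(0, y) = β(y)` has a global smooth solution: `sin` is Lipschitz, so
Picard iteration for the integrated Goursat problem converges on all of `D₁ × D₂`
(`exists_goursat`, `exists_sineGordon`). The sine-Gordon equation is the zero-curvature condition
of the Lax pair `A`, `B` (`lax_zero_curvature`), so there is a frame `U` with `U_x = UA`,
`U_y = UB`, equal to `U₊V₀` and `U₋` on the axes (`exists_flat_frame`). On horizontal lines
`U₋⁻¹U` solves `W_x = WA`, which up to the diagonal gauge `diagMat` is the equation above with
`z = λ` and `θ = φ(·, y) - β(y)`; on vertical lines `(U₊V₀)⁻¹U` solves it with `z = -1/λ` and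
`θ = -φ(x, ·)`. Hence the former is in `Λ⁺`, the latter in `Λ⁻_*`, and together they are a Birkhoff
decomposition of `U₋⁻¹U₊V₀` (`exists_extendedFrame`).

Two Birkhoff decompositions differ by a loop that extends both to an entire function of `λ` and to
an entire function of `1/λ` with value `I` at `1/λ = 0`, and Liouville's theorem makes it `I`
(`IsBirkhoff.unique`). Everything claimed about `V₊`, `T₋` and `U` can thus be read off from the
frame just described, whose smoothness follows from its partial derivatives by induction on the
order (`contDiffOn_frame`).

Intervals may contain end points. Limits at end points are avoided by writing functions as integrals
of their derivatives, and by replacing a continuous function on `D₁ × D₂`, near a given point, by a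
continuous function on the plane.
-/

noncomputable section

open Set Filter Topology MeasureTheory

namespace PSLoop

/-! ### Calculus on intervals containing the origin -/

/-- A nondegenerate interval of the real line that contains `0`; end points may belong to it or
not. -/
structure IsBasedInterval (D : Set ℝ) : Prop where
  ordConnected : D.OrdConnected
  nontrivial : D.Nontrivial
  zero_mem : (0 : ℝ) ∈ D

variable {E : Type*} [NormedAddCommGroup E] [NormedSpace ℝ E]

namespace IsBasedInterval

variable {D D₁ D₂ : Set ℝ}

theorem convex (hD : IsBasedInterval D) : Convex ℝ D :=
  convex_iff_ordConnected.2 hD.ordConnected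

theorem uniqueDiffOn (hD : IsBasedInterval D) : UniqueDiffOn ℝ D := by
  obtain ⟨a, ha, b, hb, hab⟩ := hD.nontrivial.exists_lt
  refine uniqueDiffOn_convex hD.convex ⟨(a + b) / 2, ?_⟩
  have h : Ioo a b ⊆ D := Ioo_subset_Icc_self.trans (hD.ordConnected.out ha hb)
  exact interior_maximal h isOpen_Ioo ⟨by linarith, by linarith⟩

theorem uIcc_subset (hD : IsBasedInterval D) {x : ℝ} (hx : x ∈ D) : uIcc 0 x ⊆ D :=
  hD.ordConnected.uIcc_subset hD.zero_mem hx

theorem uIoc_subset (hD : IsBasedInterval D) {x : ℝ} (hx : x ∈ D) : uIoc 0 x ⊆ D :=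
  uIoc_subset_uIcc.trans (hD.uIcc_subset hx)

/-- Every point of `D` has a relative neighbourhood that is a compact interval containing `0`. -/
theorem exists_Icc (hD : IsBasedInterval D) {x : ℝ} (hx : x ∈ D) :
    ∃ a b, a ≤ b ∧ (0 : ℝ) ∈ Icc a b ∧ x ∈ Icc a b ∧ Icc a b ⊆ D ∧ Icc a b ∈ 𝓝[D] x := by
  have hl : ∃ a ∈ D, a ≤ 0 ∧ a ≤ x ∧ Ici a ∈ 𝓝[D] x := by
    by_cases h : ∃ z ∈ D, z < 0 ∧ z < x
    · obtain ⟨z, hz, h0, h1⟩ := h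
      exact ⟨z, hz, h0.le, h1.le, mem_nhdsWithin_of_mem_nhds (Ici_mem_nhds h1)⟩
    · push Not at h
      refine ⟨min 0 x, ?_, min_le_left _ _, min_le_right _ _, ?_⟩
      · rcases min_choice 0 x with h' | h' <;> rw [h']
        exacts [hD.zero_mem, hx]
      · refine mem_of_superset self_mem_nhdsWithin fun z hz => ?_
        rw [mem_Ici, min_le_iff]
        by_cases hz0 : z < 0
        · exact Or.inr (h z hz hz0)
        · exact Or.inl (not_lt.1 hz0)
  have hr : ∃ b ∈ D, 0 ≤ b ∧ x ≤ b ∧ Iic b ∈ 𝓝[D] x := by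
    by_cases h : ∃ z ∈ D, 0 < z ∧ x < z
    · obtain ⟨z, hz, h0, h1⟩ := h
      exact ⟨z, hz, h0.le, h1.le, mem_nhdsWithin_of_mem_nhds (Iic_mem_nhds h1)⟩
    · push Not at h
      refine ⟨max 0 x, ?_, le_max_left _ _, le_max_right _ _, ?_⟩
      · rcases max_choice 0 x with h' | h' <;> rw [h']
        exacts [hD.zero_mem, hx]
      · refine mem_of_superset self_mem_nhdsWithin fun z hz => ?_
        rw [mem_Iic, le_max_iff]
        by_cases hz0 : 0 < z
        · exact Or.inr (h z hz hz0)
        · exact Or.inl (not_lt.1 hz0)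
  obtain ⟨a, ha, ha0, hax, han⟩ := hl
  obtain ⟨b, hb, hb0, hbx, hbn⟩ := hr
  refine ⟨a, b, ha0.trans hb0, ⟨ha0, hb0⟩, ⟨hax, hbx⟩, hD.ordConnected.out ha hb, ?_⟩
  rw [← Ici_inter_Iic]
  exact inter_mem han hbn

theorem intervalIntegrable {G : Type*} [NormedAddCommGroup G] (hD : IsBasedInterval D)
    {f : ℝ → G} (hf : ContinuousOn f D) {x : ℝ}
    (hx : x ∈ D) : IntervalIntegrable f volume 0 x :=
  (hf.mono (hD.uIcc_subset hx)).intervalIntegrable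

end IsBasedInterval

/-- The retraction of the line onto `[a, b]`. -/
def clamp (a b s : ℝ) : ℝ := max a (min b s)

theorem continuous_clamp (a b : ℝ) : Continuous (clamp a b) := by
  unfold clamp; fun_prop

theorem clamp_mem {a b : ℝ} (h : a ≤ b) (s : ℝ) : clamp a b s ∈ Icc a b :=
  ⟨le_max_left _ _, max_le h (min_le_left _ _)⟩

theorem clamp_of_mem {a b s : ℝ} (h : s ∈ Icc a b) : clamp a b s = s := by
  rw [clamp, min_eq_right h.2, max_eq_right h.1]

namespace IsBasedInterval

variable {D D₁ D₂ : Set ℝ}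

/-- The one-sided fundamental theorem of calculus on an interval. -/
theorem hasDerivWithinAt_integral [CompleteSpace E] (hD : IsBasedInterval D) {f : ℝ → E}
    (hf : ContinuousOn f D) {x : ℝ} (hx : x ∈ D) :
    HasDerivWithinAt (fun u => ∫ s in (0 : ℝ)..u, f s) (f x) D x := by
  obtain ⟨a, b, hab, h0, hxab, hsub, hnhds⟩ := hD.exists_Icc hx
  have hg : Continuous (fun s => f (clamp a b s)) :=
    hf.comp_continuous (continuous_clamp a b) fun s => hsub (clamp_mem hab s)
  have heq : ∀ u ∈ Icc a b, ∫ s in (0 : ℝ)..u, f s = ∫ s in (0 : ℝ)..u, f (clamp a b s) := by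
    intro u hu
    refine intervalIntegral.integral_congr fun s hs => ?_
    simp only [clamp_of_mem (ordConnected_Icc.uIcc_subset h0 hu hs)]
  have h := (intervalIntegral.integral_hasDerivAt_right (hg.intervalIntegrable 0 x)
    hg.aestronglyMeasurable.stronglyMeasurableAtFilter hg.continuousAt).hasDerivWithinAt (s := D)
  simp only [clamp_of_mem hxab] at h
  exact h.congr_of_eventuallyEq (eventually_of_mem hnhds heq) (heq x hxab)

/-- A function with derivative `f'` on an interval is the integral of `f'`. -/
theorem integral_eq_sub [CompleteSpace E] (hD : IsBasedInterval D) {f f' : ℝ → E}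
    (hf : ∀ x ∈ D, HasDerivWithinAt f (f' x) D x) (hf' : ContinuousOn f' D) {x : ℝ} (hx : x ∈ D) :
    ∫ s in (0 : ℝ)..x, f' s = f x - f 0 := by
  have hd : ∀ z ∈ D, HasDerivWithinAt (fun u => (∫ s in (0 : ℝ)..u, f' s) - f u) 0 D z := by
    intro z hz
    simpa using (hD.hasDerivWithinAt_integral hf' hz).fun_sub (hf z hz)
  have := hD.convex.norm_image_sub_le_of_norm_hasDerivWithin_le (C := 0) hd (by simp)
    hD.zero_mem hx
  simp only [intervalIntegral.integral_same, zero_sub, zero_mul, norm_le_zero_iff] at this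
  rw [eq_sub_iff_add_eq, ← sub_eq_zero, ← this]
  abel

theorem exists_box (h₁ : IsBasedInterval D₁) (h₂ : IsBasedInterval D₂) {p : ℝ × ℝ}
    (hp : p ∈ D₁ ×ˢ D₂) :
    ∃ a b c d, a ≤ b ∧ c ≤ d ∧ (0 : ℝ) ∈ Icc a b ∧ (0 : ℝ) ∈ Icc c d ∧ p ∈ Icc a b ×ˢ Icc c d ∧
      Icc a b ⊆ D₁ ∧ Icc c d ⊆ D₂ ∧ Icc a b ×ˢ Icc c d ∈ 𝓝[D₁ ×ˢ D₂] p := by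
  obtain ⟨a, b, hab, h0, hx, hs, hn⟩ := h₁.exists_Icc hp.1
  obtain ⟨c, d, hcd, h0', hy, hs', hn'⟩ := h₂.exists_Icc hp.2
  refine ⟨a, b, c, d, hab, hcd, h0, h0', ⟨hx, hy⟩, hs, hs', ?_⟩
  rw [nhdsWithin_prod_eq p.1 p.2]
  exact prod_mem_prod hn hn'

/-- Continuity of `(x, y) ↦ ∫₀ʸ f(x, t) dt` on a product of intervals. -/
theorem continuousOn_integral_right (h₁ : IsBasedInterval D₁) (h₂ : IsBasedInterval D₂)
    {f : ℝ → ℝ → E} (hf : ContinuousOn (fun p : ℝ × ℝ => f p.1 p.2) (D₁ ×ˢ D₂)) :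
    ContinuousOn (fun p : ℝ × ℝ => ∫ t in (0 : ℝ)..p.2, f p.1 t) (D₁ ×ˢ D₂) := by
  intro p hp
  obtain ⟨a, b, c, d, hab, hcd, h0, h0', hpb, hs, hs', hn⟩ := h₁.exists_box h₂ hp
  have hg : Continuous (fun q : ℝ × ℝ => f (clamp a b q.1) (clamp c d q.2)) :=
    hf.comp_continuous (f := fun q : ℝ × ℝ => (clamp a b q.1, clamp c d q.2))
      (((continuous_clamp a b).comp continuous_fst).prodMk
        ((continuous_clamp c d).comp continuous_snd))
      fun q => ⟨hs (clamp_mem hab _), hs' (clamp_mem hcd _)⟩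
  have hG := intervalIntegral.continuous_parametric_primitive_of_continuous (μ := volume)
    (a₀ := 0) (f := fun x t => f (clamp a b x) (clamp c d t)) hg
  have heq : ∀ q ∈ Icc a b ×ˢ Icc c d, ∫ t in (0 : ℝ)..q.2, f q.1 t
      = ∫ t in (0 : ℝ)..q.2, f (clamp a b q.1) (clamp c d t) := by
    intro q hq
    refine intervalIntegral.integral_congr fun t ht => ?_
    simp only [clamp_of_mem hq.1, clamp_of_mem (ordConnected_Icc.uIcc_subset h0' hq.2 ht)]
  exact hG.continuousAt.continuousWithinAt.congr_of_eventuallyEq (eventually_of_mem hn heq)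
    (heq p hpb)

end IsBasedInterval

section Slices

variable {G : Type*} [TopologicalSpace G] {D₁ D₂ : Set ℝ}

theorem mapsTo_swap_prod (A B : Set ℝ) : MapsTo Prod.swap (A ×ˢ B) (B ×ˢ A) :=
  fun _ h => ⟨h.2, h.1⟩

theorem continuousOn_swap {f : ℝ → ℝ → G}
    (hf : ContinuousOn (fun p : ℝ × ℝ => f p.1 p.2) (D₁ ×ˢ D₂)) :
    ContinuousOn (fun p : ℝ × ℝ => f p.2 p.1) (D₂ ×ˢ D₁) :=
  hf.comp continuous_swap.continuousOn (mapsTo_swap_prod _ _)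

theorem contDiffOn_swap {n : ℕ∞ω} {f : ℝ → ℝ → E}
    (hf : ContDiffOn ℝ n (fun p : ℝ × ℝ => f p.1 p.2) (D₁ ×ˢ D₂)) :
    ContDiffOn ℝ n (fun p : ℝ × ℝ => f p.2 p.1) (D₂ ×ˢ D₁) :=
  hf.comp (contDiff_snd.prodMk contDiff_fst).contDiffOn (mapsTo_swap_prod _ _)

theorem continuousOn_left {f : ℝ → ℝ → G}
    (hf : ContinuousOn (fun p : ℝ × ℝ => f p.1 p.2) (D₁ ×ˢ D₂)) {y : ℝ}
    (hy : y ∈ D₂) : ContinuousOn (fun x => f x y) D₁ :=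
  hf.comp (f := fun x => (x, y)) (by fun_prop) fun _ hx => ⟨hx, hy⟩

theorem continuousOn_right {f : ℝ → ℝ → G}
    (hf : ContinuousOn (fun p : ℝ × ℝ => f p.1 p.2) (D₁ ×ˢ D₂)) {x : ℝ}
    (hx : x ∈ D₁) : ContinuousOn (fun y => f x y) D₂ :=
  hf.comp (f := fun y => (x, y)) (by fun_prop) fun _ hy => ⟨hx, hy⟩

theorem continuousOn_comp_fst {g : ℝ → G} (hg : ContinuousOn g D₁) :
    ContinuousOn (fun p : ℝ × ℝ => g p.1) (D₁ ×ˢ D₂) :=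
  hg.comp continuousOn_fst fun _ hp => hp.1

theorem continuousOn_comp_snd {g : ℝ → G} (hg : ContinuousOn g D₂) :
    ContinuousOn (fun p : ℝ × ℝ => g p.2) (D₁ ×ˢ D₂) :=
  hg.comp continuousOn_snd fun _ hp => hp.2

theorem contDiffOn_comp_fst {n : ℕ∞ω} {g : ℝ → E} (hg : ContDiffOn ℝ n g D₁) :
    ContDiffOn ℝ n (fun p : ℝ × ℝ => g p.1) (D₁ ×ˢ D₂) :=
  hg.comp contDiff_fst.contDiffOn fun _ hp => hp.1

theorem contDiffOn_comp_snd {n : ℕ∞ω} {g : ℝ → E} (hg : ContDiffOn ℝ n g D₂) :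
    ContDiffOn ℝ n (fun p : ℝ × ℝ => g p.2) (D₁ ×ˢ D₂) :=
  hg.comp contDiff_snd.contDiffOn fun _ hp => hp.2

end Slices

namespace IsBasedInterval

variable {D D₁ D₂ : Set ℝ}

theorem continuousOn_integral_left (h₁ : IsBasedInterval D₁) (h₂ : IsBasedInterval D₂)
    {f : ℝ → ℝ → E} (hf : ContinuousOn (fun p : ℝ × ℝ => f p.1 p.2) (D₁ ×ˢ D₂)) :
    ContinuousOn (fun p : ℝ × ℝ => ∫ s in (0 : ℝ)..p.1, f s p.2) (D₁ ×ˢ D₂) :=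
  continuousOn_swap (f := fun y x => ∫ s in (0 : ℝ)..x, f s y)
    (h₂.continuousOn_integral_right h₁ (f := fun y x => f x y) (continuousOn_swap hf))

theorem integral_swap (h₁ : IsBasedInterval D₁) (h₂ : IsBasedInterval D₂)
    {f : ℝ → ℝ → E} (hf : ContinuousOn (fun p : ℝ × ℝ => f p.1 p.2) (D₁ ×ˢ D₂)) {x y : ℝ}
    (hx : x ∈ D₁) (hy : y ∈ D₂) :
    ∫ s in (0 : ℝ)..x, ∫ t in (0 : ℝ)..y, f s t = ∫ t in (0 : ℝ)..y, ∫ s in (0 : ℝ)..x, f s t := by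
  refine intervalIntegral_intervalIntegral_swap ?_
  have hc : IsCompact (uIcc 0 x ×ˢ uIcc 0 y) := isCompact_uIcc.prod isCompact_uIcc
  have hsub := prod_mono (h₁.uIcc_subset hx) (h₂.uIcc_subset hy)
  exact ((hf.mono hsub).integrableOn_compact hc).mono_set
    (prod_mono uIoc_subset_uIcc uIoc_subset_uIcc)

/-- A function on a product of intervals with continuous partial derivatives (one-sided at the
ends) is differentiable. -/
theorem hasFDerivWithinAt_of_partials (h₁ : IsBasedInterval D₁)
    {f fx fy : ℝ → ℝ → E}
    (hx : ∀ x ∈ D₁, ∀ y ∈ D₂, HasDerivWithinAt (fun s => f s y) (fx x y) D₁ x)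
    (hy : ∀ x ∈ D₁, ∀ y ∈ D₂, HasDerivWithinAt (fun t => f x t) (fy x y) D₂ y)
    (hfx : ContinuousOn (fun p : ℝ × ℝ => fx p.1 p.2) (D₁ ×ˢ D₂)) {p : ℝ × ℝ}
    (hp : p ∈ D₁ ×ˢ D₂) :
    HasFDerivWithinAt (fun q : ℝ × ℝ => f q.1 q.2)
      ((ContinuousLinearMap.fst ℝ ℝ ℝ).smulRight (fx p.1 p.2)
        + (ContinuousLinearMap.snd ℝ ℝ ℝ).smulRight (fy p.1 p.2)) (D₁ ×ˢ D₂) p := by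
  obtain ⟨x, y⟩ := p
  rw [hasFDerivWithinAt_iff_isLittleO, Asymptotics.isLittleO_iff]
  intro ε hε
  have hy' := (hasDerivWithinAt_iff_isLittleO.1 (hy x hp.1 y hp.2))
  have e1 : ∀ᶠ t in 𝓝[D₂] y, ‖f x t - f x y - (t - y) • fy x y‖ ≤ ε / 2 * ‖t - y‖ :=
    (Asymptotics.isLittleO_iff.1 hy') (half_pos hε)
  have e2 : ∀ᶠ q in 𝓝[D₁ ×ˢ D₂] (x, y), ‖fx q.1 q.2 - fx x y‖ < ε / 2 := by
    have := (hfx (x, y) hp).eventually (Metric.ball_mem_nhds _ (half_pos hε))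
    simpa [dist_eq_norm] using this
  obtain ⟨δ, hδ, hball⟩ := Metric.mem_nhdsWithin_iff.1 e2
  have e3 : ∀ᶠ q in 𝓝[D₁ ×ˢ D₂] (x, y), q ∈ Metric.ball (x, y) δ :=
    mem_nhdsWithin_of_mem_nhds (Metric.ball_mem_nhds _ hδ)
  have e1' : ∀ᶠ q : ℝ × ℝ in 𝓝[D₁ ×ˢ D₂] (x, y),
      ‖f x q.2 - f x y - (q.2 - y) • fy x y‖ ≤ ε / 2 * ‖q.2 - y‖ := by
    rw [nhdsWithin_prod_eq]
    exact e1.prod_inr _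
  filter_upwards [e1', e3, self_mem_nhdsWithin] with q hq1 hq3 hqD
  rw [← ball_prod_same] at hq3
  -- the mean value inequality on the horizontal segment from `(x, q.2)` to `q`
  have hmv : ‖f q.1 q.2 - f x q.2 - (q.1 - x) • fx x y‖ ≤ ε / 2 * ‖q.1 - x‖ := by
    have hc : Convex ℝ (D₁ ∩ Metric.ball x δ) := h₁.convex.inter (convex_ball x δ)
    have hd : ∀ s ∈ D₁ ∩ Metric.ball x δ,
        HasDerivWithinAt (fun s => f s q.2 - (s - x) • fx x y) (fx s q.2 - fx x y)
          (D₁ ∩ Metric.ball x δ) s := by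
      intro s hs
      have h1 := (hx s hs.1 q.2 hqD.2).mono (inter_subset_left (t := Metric.ball x δ))
      have h2 : HasDerivWithinAt (fun s : ℝ => (s - x) • fx x y) ((1 : ℝ) • fx x y)
          (D₁ ∩ Metric.ball x δ) s :=
        ((hasDerivWithinAt_id s _).sub_const x).smul_const _
      simpa using h1.fun_sub h2
    have hb : ∀ s ∈ D₁ ∩ Metric.ball x δ, ‖fx s q.2 - fx x y‖ ≤ ε / 2 := by
      intro s hs
      have : (s, q.2) ∈ Metric.ball (x, y) δ ∩ D₁ ×ˢ D₂ := by
        refine ⟨?_, hs.1, hqD.2⟩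
        rw [← ball_prod_same]
        exact ⟨hs.2, hq3.2⟩
      exact le_of_lt (hball this)
    have := hc.norm_image_sub_le_of_norm_hasDerivWithin_le hd hb
      ⟨hp.1, Metric.mem_ball_self hδ⟩ ⟨hqD.1, hq3.1⟩
    simpa [sub_right_comm] using this
  have hn1 : ‖q.1 - x‖ ≤ ‖q - (x, y)‖ := norm_fst_le (q - (x, y))
  have hn2 : ‖q.2 - y‖ ≤ ‖q - (x, y)‖ := norm_snd_le (q - (x, y))
  calc ‖f q.1 q.2 - f x y - ((ContinuousLinearMap.fst ℝ ℝ ℝ).smulRight (fx x y)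
        + (ContinuousLinearMap.snd ℝ ℝ ℝ).smulRight (fy x y)) (q - (x, y))‖
      = ‖(f q.1 q.2 - f x q.2 - (q.1 - x) • fx x y)
          + (f x q.2 - f x y - (q.2 - y) • fy x y)‖ := by
        congr 1
        simp
        abel
    _ ≤ ε / 2 * ‖q.1 - x‖ + ε / 2 * ‖q.2 - y‖ := (norm_add_le _ _).trans (add_le_add hmv hq1)
    _ ≤ ε * ‖q - (x, y)‖ := by nlinarith [hε.le]

/-- A function on a product of intervals whose partial derivatives are of class `Cⁿ` is of class
`Cⁿ⁺¹`. -/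
theorem contDiffOn_of_partials (h₁ : IsBasedInterval D₁) (h₂ : IsBasedInterval D₂)
    {f fx fy : ℝ → ℝ → E} (n : ℕ)
    (hx : ∀ x ∈ D₁, ∀ y ∈ D₂, HasDerivWithinAt (fun s => f s y) (fx x y) D₁ x)
    (hy : ∀ x ∈ D₁, ∀ y ∈ D₂, HasDerivWithinAt (fun t => f x t) (fy x y) D₂ y)
    (hfx : ContDiffOn ℝ n (fun p : ℝ × ℝ => fx p.1 p.2) (D₁ ×ˢ D₂))
    (hfy : ContDiffOn ℝ n (fun p : ℝ × ℝ => fy p.1 p.2) (D₁ ×ˢ D₂)) :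
    ContDiffOn ℝ (n + 1) (fun p : ℝ × ℝ => f p.1 p.2) (D₁ ×ˢ D₂) := by
  rw [contDiffOn_succ_iff_hasFDerivWithinAt_of_uniqueDiffOn
    (h₁.uniqueDiffOn.prod h₂.uniqueDiffOn)]
  refine ⟨fun h => by simp at h, _, ?_, fun p hp =>
    h₁.hasFDerivWithinAt_of_partials hx hy hfx.continuousOn hp⟩
  exact (((ContinuousLinearMap.smulRightL ℝ (ℝ × ℝ) E
      (ContinuousLinearMap.fst ℝ ℝ ℝ)).contDiff.comp_contDiffOn hfx)).add
    (((ContinuousLinearMap.smulRightL ℝ (ℝ × ℝ) E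
      (ContinuousLinearMap.snd ℝ ℝ ℝ)).contDiff.comp_contDiffOn hfy))

/-- The first partial derivative of a `Cⁿ⁺¹` function on a product of intervals. -/
theorem exists_partial_fst (h₁ : IsBasedInterval D₁) (h₂ : IsBasedInterval D₂) {f : ℝ → ℝ → E}
    {n : ℕ} (hf : ContDiffOn ℝ (n + 1) (fun p : ℝ × ℝ => f p.1 p.2) (D₁ ×ˢ D₂)) :
    ∃ fx : ℝ → ℝ → E, ContDiffOn ℝ n (fun p : ℝ × ℝ => fx p.1 p.2) (D₁ ×ˢ D₂) ∧
      ∀ x ∈ D₁, ∀ y ∈ D₂, HasDerivWithinAt (fun s => f s y) (fx x y) D₁ x := by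
  obtain ⟨-, f', hf', hd⟩ := (contDiffOn_succ_iff_hasFDerivWithinAt_of_uniqueDiffOn
    (h₁.uniqueDiffOn.prod h₂.uniqueDiffOn)).1 hf
  refine ⟨fun x y => f' (x, y) (1, 0), hf'.clm_apply contDiffOn_const, fun x hx y hy => ?_⟩
  have hc : HasDerivWithinAt (fun s : ℝ => (s, y)) ((1 : ℝ), (0 : ℝ)) D₁ x :=
    (hasDerivWithinAt_id x _).prodMk (hasDerivWithinAt_const x _ y)
  exact (hd (x, y) ⟨hx, hy⟩).comp_hasDerivWithinAt x hc
    (show MapsTo (fun s : ℝ => (s, y)) D₁ (D₁ ×ˢ D₂) from fun s hs => ⟨hs, hy⟩)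

variable [CompleteSpace E]

/-- The `x`-derivative of `∫₀ʸ f(x, t) dt`; integration in `t` and the fundamental theorem in `x`
are exchanged by Fubini's theorem, so that end points need no separate treatment. -/
theorem hasDerivWithinAt_integral_right (h₁ : IsBasedInterval D₁) (h₂ : IsBasedInterval D₂)
    {f fx : ℝ → ℝ → E} (hf : ContinuousOn (fun p : ℝ × ℝ => f p.1 p.2) (D₁ ×ˢ D₂))
    (hfx : ContinuousOn (fun p : ℝ × ℝ => fx p.1 p.2) (D₁ ×ˢ D₂))
    (hx : ∀ x ∈ D₁, ∀ y ∈ D₂, HasDerivWithinAt (fun s => f s y) (fx x y) D₁ x)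
    {x y : ℝ} (hxD : x ∈ D₁) (hyD : y ∈ D₂) :
    HasDerivWithinAt (fun s => ∫ t in (0 : ℝ)..y, f s t) (∫ t in (0 : ℝ)..y, fx x t) D₁ x := by
  have key : ∀ s ∈ D₁, ∫ t in (0 : ℝ)..y, f s t
      = (∫ t in (0 : ℝ)..y, f 0 t) + ∫ r in (0 : ℝ)..s, ∫ t in (0 : ℝ)..y, fx r t := by
    intro s hs
    rw [h₁.integral_swap h₂ hfx hs hyD, ← sub_eq_iff_eq_add',
      ← intervalIntegral.integral_sub
        (h₂.intervalIntegrable (continuousOn_right hf hs) hyD)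
        (h₂.intervalIntegrable (continuousOn_right hf h₁.zero_mem) hyD)]
    refine intervalIntegral.integral_congr fun t ht => ?_
    have ht' : t ∈ D₂ := h₂.uIcc_subset hyD ht
    exact (h₁.integral_eq_sub (fun r hr => hx r hr t ht') (continuousOn_left hfx ht') hs).symm
  have hd := (h₁.hasDerivWithinAt_integral
    (continuousOn_left (f := fun x y => ∫ t in (0 : ℝ)..y, fx x t)
      (h₁.continuousOn_integral_right h₂ hfx) hyD) hxD).const_add
      (∫ t in (0 : ℝ)..y, f 0 t)
  exact hd.congr key (key x hxD)

theorem contDiffOn_integral_right (h₁ : IsBasedInterval D₁) (h₂ : IsBasedInterval D₂) (n : ℕ) :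
    ∀ {f : ℝ → ℝ → E}, ContDiffOn ℝ n (fun p : ℝ × ℝ => f p.1 p.2) (D₁ ×ˢ D₂) →
    ContDiffOn ℝ n (fun p : ℝ × ℝ => ∫ t in (0 : ℝ)..p.2, f p.1 t) (D₁ ×ˢ D₂) := by
  induction n with
  | zero =>
    intro f hf
    simp only [Nat.cast_zero, contDiffOn_zero] at hf ⊢
    exact h₁.continuousOn_integral_right h₂ hf
  | succ n ih =>
    intro f hf
    push_cast at hf ⊢
    obtain ⟨fx, hfx, hd⟩ := h₁.exists_partial_fst h₂ hf
    refine h₁.contDiffOn_of_partials h₂ (f := fun x y => ∫ t in (0 : ℝ)..y, f x t)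
      (fy := f) n (fun x hx y hy =>
        h₁.hasDerivWithinAt_integral_right h₂ hf.continuousOn hfx.continuousOn hd hx hy)
      (fun x hx y hy => h₂.hasDerivWithinAt_integral (continuousOn_right hf.continuousOn hx) hy)
      (ih hfx) (hf.of_le (by exact_mod_cast Nat.le_succ n))

theorem contDiffOn_integral_left (h₁ : IsBasedInterval D₁) (h₂ : IsBasedInterval D₂) (n : ℕ)
    {f : ℝ → ℝ → E} (hf : ContDiffOn ℝ n (fun p : ℝ × ℝ => f p.1 p.2) (D₁ ×ˢ D₂)) :
    ContDiffOn ℝ n (fun p : ℝ × ℝ => ∫ s in (0 : ℝ)..p.1, f s p.2) (D₁ ×ˢ D₂) :=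
  contDiffOn_swap (f := fun y x => ∫ s in (0 : ℝ)..x, f s y)
    (h₂.contDiffOn_integral_right h₁ n (f := fun y x => f x y) (contDiffOn_swap hf))

end IsBasedInterval

/-! ### The Goursat problem -/

section Goursat

variable {E : Type*} [NormedAddCommGroup E] [NormedSpace ℝ E] {D₁ D₂ : Set ℝ}

theorem norm_integral_le_of_norm_le_mul_pow {f : ℝ → E} {x K : ℝ} (n : ℕ)
    (h : ∀ s ∈ uIoc 0 x, ‖f s‖ ≤ K * |s| ^ n) :
    ‖∫ s in (0 : ℝ)..x, f s‖ ≤ K * (|x| ^ (n + 1) / (n + 1)) := by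
  have hi : IntegrableOn (fun s : ℝ => K * |s| ^ n) (uIoc 0 x) :=
    intervalIntegrable_iff.1 ((by fun_prop : Continuous fun s : ℝ => K * |s| ^ n).intervalIntegrable
      0 x)
  have hp := integral_pow_abs_sub_uIoc (a := 0) (b := x) n
  simp only [sub_zero] at hp
  calc ‖∫ s in (0 : ℝ)..x, f s‖ = ‖∫ s in uIoc 0 x, f s‖ :=
        intervalIntegral.norm_intervalIntegral_eq _ _ _ _
    _ ≤ ∫ s in uIoc 0 x, K * |s| ^ n :=
        norm_integral_le_of_norm_le hi ((ae_restrict_iff' measurableSet_uIoc).2 (ae_of_all _ h))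
    _ = K * (|x| ^ (n + 1) / (n + 1)) := by rw [integral_const_mul, hp]

theorem norm_integral_integral_sub_le (h₁ : IsBasedInterval D₁) (h₂ : IsBasedInterval D₂)
    {f g : ℝ → ℝ → E} (hf : ContinuousOn (fun p : ℝ × ℝ => f p.1 p.2) (D₁ ×ˢ D₂))
    (hg : ContinuousOn (fun p : ℝ × ℝ => g p.1 p.2) (D₁ ×ˢ D₂)) {x y K : ℝ} (n : ℕ)
    (hx : x ∈ D₁) (hy : y ∈ D₂)
    (h : ∀ s ∈ uIcc 0 x, ∀ t ∈ uIcc 0 y, ‖f s t - g s t‖ ≤ K * |s| ^ n) :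
    ‖(∫ s in (0 : ℝ)..x, ∫ t in (0 : ℝ)..y, f s t) - ∫ s in (0 : ℝ)..x, ∫ t in (0 : ℝ)..y, g s t‖
      ≤ K * |y| * (|x| ^ (n + 1) / (n + 1)) := by
  rw [← intervalIntegral.integral_sub
    (h₁.intervalIntegrable (continuousOn_left (f := fun s y => ∫ t in (0 : ℝ)..y, f s t)
      (h₁.continuousOn_integral_right h₂ hf) hy) hx)
    (h₁.intervalIntegrable (continuousOn_left (f := fun s y => ∫ t in (0 : ℝ)..y, g s t)
      (h₁.continuousOn_integral_right h₂ hg) hy) hx)]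
  refine norm_integral_le_of_norm_le_mul_pow n fun s hs => ?_
  have hs' : s ∈ D₁ := h₁.uIoc_subset hx hs
  rw [← intervalIntegral.integral_sub (h₂.intervalIntegrable (continuousOn_right hf hs') hy)
    (h₂.intervalIntegrable (continuousOn_right hg hs') hy)]
  have := intervalIntegral.norm_integral_le_of_norm_le_const (a := 0) (b := y)
    (f := fun t => f s t - g s t) (C := K * |s| ^ n)
    fun t ht => h s (uIoc_subset_uIcc hs) t (uIoc_subset_uIcc ht)
  rw [sub_zero] at this
  linarith

/-- The Picard iterates of the Goursat problem `u_xy = F(x, y, u)` in integrated form. -/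
def goursatIterate (g : ℝ → ℝ → E) (F : ℝ → ℝ → E → E) : ℕ → ℝ → ℝ → E
  | 0 => g
  | n + 1 => fun x y =>
      g x y + ∫ s in (0 : ℝ)..x, ∫ t in (0 : ℝ)..y, F s t (goursatIterate g F n s t)

/-- `F(x, y, u)` is Lipschitz in `u`, uniformly for `(x, y)` in any compact box inside
`D₁ × D₂`. -/
def LipschitzOnBoxes (D₁ D₂ : Set ℝ) (F : ℝ → ℝ → E → E) : Prop :=
  ∀ a b c d, Icc a b ⊆ D₁ → Icc c d ⊆ D₂ → ∃ L, 0 ≤ L ∧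
    ∀ s ∈ Icc a b, ∀ t ∈ Icc c d, ∀ u v, ‖F s t u - F s t v‖ ≤ L * ‖u - v‖

theorem continuousOn_comp_goursat {G : Type*} [TopologicalSpace G] {F : ℝ → ℝ → G → G}
    (hF : ContinuousOn (fun q : (ℝ × ℝ) × G => F q.1.1 q.1.2 q.2) ((D₁ ×ˢ D₂) ×ˢ univ))
    {u : ℝ → ℝ → G} (hu : ContinuousOn (fun p : ℝ × ℝ => u p.1 p.2) (D₁ ×ˢ D₂)) :
    ContinuousOn (fun p : ℝ × ℝ => F p.1 p.2 (u p.1 p.2)) (D₁ ×ˢ D₂) :=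
  hF.comp (f := fun p : ℝ × ℝ => (p, u p.1 p.2)) (continuousOn_id.prodMk hu)
    fun _ hp => ⟨hp, mem_univ _⟩

theorem continuousOn_integral_integral (h₁ : IsBasedInterval D₁) (h₂ : IsBasedInterval D₂)
    {f : ℝ → ℝ → E} (hf : ContinuousOn (fun p : ℝ × ℝ => f p.1 p.2) (D₁ ×ˢ D₂)) :
    ContinuousOn (fun p : ℝ × ℝ => ∫ s in (0 : ℝ)..p.1, ∫ t in (0 : ℝ)..p.2, f s t) (D₁ ×ˢ D₂) :=
  h₁.continuousOn_integral_left h₂ (f := fun s y => ∫ t in (0 : ℝ)..y, f s t)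
    (h₁.continuousOn_integral_right h₂ hf)

theorem continuousOn_goursatIterate (h₁ : IsBasedInterval D₁) (h₂ : IsBasedInterval D₂)
    {g : ℝ → ℝ → E} {F : ℝ → ℝ → E → E}
    (hg : ContinuousOn (fun p : ℝ × ℝ => g p.1 p.2) (D₁ ×ˢ D₂))
    (hF : ContinuousOn (fun q : (ℝ × ℝ) × E => F q.1.1 q.1.2 q.2) ((D₁ ×ˢ D₂) ×ˢ univ)) (n : ℕ) :
    ContinuousOn (fun p : ℝ × ℝ => goursatIterate g F n p.1 p.2) (D₁ ×ˢ D₂) := by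
  induction n with
  | zero => exact hg
  | succ n ih =>
    exact hg.add (continuousOn_integral_integral h₁ h₂
      (f := fun s t => F s t (goursatIterate g F n s t)) (continuousOn_comp_goursat hF ih))

/-- The Picard iterates converge, uniformly on compact boxes: consecutive iterates differ by at
most `C (L R |x|)ⁿ / n!` where `|y| ≤ R`. -/
theorem tendstoUniformlyOn_goursatIterate [CompleteSpace E]
    (h₁ : IsBasedInterval D₁) (h₂ : IsBasedInterval D₂)
    {g : ℝ → ℝ → E} {F : ℝ → ℝ → E → E}
    (hg : ContinuousOn (fun p : ℝ × ℝ => g p.1 p.2) (D₁ ×ˢ D₂))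
    (hF : ContinuousOn (fun q : (ℝ × ℝ) × E => F q.1.1 q.1.2 q.2) ((D₁ ×ˢ D₂) ×ˢ univ))
    (hL : LipschitzOnBoxes D₁ D₂ F) :
    ∃ u : ℝ → ℝ → E, ∀ a b c d, (0 : ℝ) ∈ Icc a b → (0 : ℝ) ∈ Icc c d → Icc a b ⊆ D₁ →
      Icc c d ⊆ D₂ → TendstoUniformlyOn (fun n (p : ℝ × ℝ) => goursatIterate g F n p.1 p.2)
        (fun p => u p.1 p.2) atTop (Icc a b ×ˢ Icc c d) := by
  set w : ℕ → ℝ × ℝ → E := fun n p =>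
    goursatIterate g F (n + 1) p.1 p.2 - goursatIterate g F n p.1 p.2 with hw
  refine ⟨fun x y => g x y + ∑' n, w n (x, y), fun a b c d h0 h0' hs hs' => ?_⟩
  have hcont := continuousOn_goursatIterate h₁ h₂ hg hF
  obtain ⟨L, hL0, hLip⟩ := hL a b c d hs hs'
  have hK : IsCompact (Icc a b ×ˢ Icc c d) := isCompact_Icc.prod isCompact_Icc
  have hsub : Icc a b ×ˢ Icc c d ⊆ D₁ ×ˢ D₂ := prod_mono hs hs'
  obtain ⟨C, hC⟩ := hK.exists_bound_of_continuousOn (((hcont 1).sub (hcont 0)).mono hsub)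
  have hC0 : 0 ≤ C := (norm_nonneg _).trans (hC (0, 0) ⟨h0, h0'⟩)
  set R : ℝ := max |c| |d| with hR
  set R' : ℝ := max |a| |b| with hR'
  have hRy : ∀ y ∈ Icc c d, |y| ≤ R := fun y hy => abs_le_max_abs_abs hy.1 hy.2
  have hRx : ∀ x ∈ Icc a b, |x| ≤ R' := fun x hx => abs_le_max_abs_abs hx.1 hx.2
  have hR0 : 0 ≤ R := (abs_nonneg c).trans (le_max_left _ _)
  have hest : ∀ n, ∀ x ∈ Icc a b, ∀ y ∈ Icc c d,
      ‖w n (x, y)‖ ≤ C * (L * R) ^ n / n.factorial * |x| ^ n := by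
    intro n
    induction n with
    | zero =>
      intro x hx y hy
      simpa using hC (x, y) ⟨hx, hy⟩
    | succ n ih =>
      intro x hx y hy
      have hb : ∀ s ∈ uIcc 0 x, ∀ t ∈ uIcc 0 y,
          ‖F s t (goursatIterate g F (n + 1) s t) - F s t (goursatIterate g F n s t)‖
            ≤ L * (C * (L * R) ^ n / n.factorial) * |s| ^ n := by
        intro s hs0 t ht0
        have hs1 := ordConnected_Icc.uIcc_subset h0 hx hs0
        have ht1 := ordConnected_Icc.uIcc_subset h0' hy ht0
        have := mul_le_mul_of_nonneg_left (ih s hs1 t ht1) hL0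
        rw [mul_assoc]
        exact (hLip s hs1 t ht1 _ _).trans this
      have hd := norm_integral_integral_sub_le h₁ h₂
        (f := fun s t => F s t (goursatIterate g F (n + 1) s t))
        (g := fun s t => F s t (goursatIterate g F n s t))
        (continuousOn_comp_goursat hF (hcont (n + 1))) (continuousOn_comp_goursat hF (hcont n)) n
        (hs hx) (hs' hy) hb
      have he : w (n + 1) (x, y)
          = (∫ s in (0 : ℝ)..x, ∫ t in (0 : ℝ)..y, F s t (goursatIterate g F (n + 1) s t))
            - ∫ s in (0 : ℝ)..x, ∫ t in (0 : ℝ)..y, F s t (goursatIterate g F n s t) := by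
        simp only [hw, goursatIterate]
        exact add_sub_add_left_eq_sub _ _ _
      rw [he]
      refine hd.trans ?_
      have hy' := hRy y hy
      rw [Nat.factorial_succ]
      push_cast
      have hn : (0 : ℝ) < n + 1 := by positivity
      have hnf : (0 : ℝ) < n.factorial := by positivity
      calc L * (C * (L * R) ^ n / n.factorial) * |y| * (|x| ^ (n + 1) / (n + 1))
          ≤ L * (C * (L * R) ^ n / n.factorial) * R * (|x| ^ (n + 1) / (n + 1)) := by gcongr
        _ = C * (L * R) ^ (n + 1) / ((n + 1) * n.factorial) * |x| ^ (n + 1) := by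
          field_simp
          ring
  have hsum : Summable fun n : ℕ => C * ((L * R * R') ^ n / n.factorial) :=
    (Real.summable_pow_div_factorial _).mul_left C
  have hT := tendstoUniformlyOn_tsum_nat (f := w) (s := Icc a b ×ˢ Icc c d) hsum
    (fun n p hp => by
      refine (hest n p.1 hp.1 p.2 hp.2).trans ?_
      have := hRx p.1 hp.1
      calc C * (L * R) ^ n / n.factorial * |p.1| ^ n
          ≤ C * (L * R) ^ n / n.factorial * R' ^ n := by gcongr
        _ = C * ((L * R * R') ^ n / n.factorial) := by rw [mul_pow (L * R)]; ring)
  rw [Metric.tendstoUniformlyOn_iff] at hT ⊢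
  intro ε hε
  filter_upwards [hT ε hε] with n hn p hp
  have := hn p hp
  simp only [hw, Finset.sum_range_sub (fun n => goursatIterate g F n p.1 p.2)] at this
  rw [dist_eq_norm] at this ⊢
  convert this using 2
  simp only [goursatIterate, hw]
  abel

/-- Existence of a global solution of the Goursat problem, in integrated form. -/
theorem exists_goursat [CompleteSpace E] (h₁ : IsBasedInterval D₁) (h₂ : IsBasedInterval D₂)
    {g : ℝ → ℝ → E} {F : ℝ → ℝ → E → E}
    (hg : ContinuousOn (fun p : ℝ × ℝ => g p.1 p.2) (D₁ ×ˢ D₂))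
    (hF : ContinuousOn (fun q : (ℝ × ℝ) × E => F q.1.1 q.1.2 q.2) ((D₁ ×ˢ D₂) ×ˢ univ))
    (hL : LipschitzOnBoxes D₁ D₂ F) :
    ∃ u : ℝ → ℝ → E, ContinuousOn (fun p : ℝ × ℝ => u p.1 p.2) (D₁ ×ˢ D₂) ∧
      ∀ x ∈ D₁, ∀ y ∈ D₂,
        u x y = g x y + ∫ s in (0 : ℝ)..x, ∫ t in (0 : ℝ)..y, F s t (u s t) := by
  obtain ⟨u, hu⟩ := tendstoUniformlyOn_goursatIterate h₁ h₂ hg hF hL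
  have hcont := continuousOn_goursatIterate h₁ h₂ hg hF
  have huc : ContinuousOn (fun p : ℝ × ℝ => u p.1 p.2) (D₁ ×ˢ D₂) := by
    intro p hp
    obtain ⟨a, b, c, d, hab, hcd, h0, h0', hpb, hs, hs', hn⟩ := h₁.exists_box h₂ hp
    have h := (hu a b c d h0 h0' hs hs').continuousOn
      (Frequently.of_forall fun n => (hcont n).mono (prod_mono hs hs'))
    exact (h p hpb).mono_of_mem_nhdsWithin hn
  refine ⟨u, huc, fun x hx y hy => ?_⟩
  obtain ⟨a, b, c, d, hab, hcd, h0, h0', hpb, hs, hs', -⟩ :=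
    h₁.exists_box h₂ (p := (x, y)) ⟨hx, hy⟩
  obtain ⟨L, hL0, hLip⟩ := hL a b c d hs hs'
  have hT := hu a b c d h0 h0' hs hs'
  -- both sides are within a multiple of `ε` of a late Picard iterate
  have hle : ∀ ε > 0, ‖u x y - (g x y + ∫ s in (0 : ℝ)..x, ∫ t in (0 : ℝ)..y, F s t (u s t))‖
      ≤ ε * (1 + L * |y| * |x|) := by
    intro ε hε
    obtain ⟨N, hN⟩ := eventually_atTop.1 (Metric.tendstoUniformlyOn_iff.1 hT ε hε)
    have hd := norm_integral_integral_sub_le h₁ h₂ (K := L * ε)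
        (f := fun s t => F s t (goursatIterate g F N s t)) (g := fun s t => F s t (u s t))
        (continuousOn_comp_goursat hF (hcont N)) (continuousOn_comp_goursat hF huc) 0 hx hy (by
      intro s hs0 t ht0
      have hs1 := ordConnected_Icc.uIcc_subset h0 hpb.1 hs0
      have ht1 := ordConnected_Icc.uIcc_subset h0' hpb.2 ht0
      have h3 := hN N le_rfl (s, t) ⟨hs1, ht1⟩
      rw [dist_comm, dist_eq_norm] at h3
      rw [pow_zero, mul_one]
      exact (hLip s hs1 t ht1 _ _).trans (mul_le_mul_of_nonneg_left h3.le hL0))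
    have h4 := hN (N + 1) (Nat.le_succ N) (x, y) hpb
    rw [dist_eq_norm] at h4
    simp only [goursatIterate] at h4
    calc _ = ‖(u x y - (g x y
            + ∫ s in (0 : ℝ)..x, ∫ t in (0 : ℝ)..y, F s t (goursatIterate g F N s t)))
          + ((∫ s in (0 : ℝ)..x, ∫ t in (0 : ℝ)..y, F s t (goursatIterate g F N s t))
            - ∫ s in (0 : ℝ)..x, ∫ t in (0 : ℝ)..y, F s t (u s t))‖ := by congr 1; abel
      _ ≤ _ := norm_add_le _ _
      _ ≤ ε + L * ε * |y| * (|x| ^ (0 + 1) / ((0 : ℕ) + 1)) := add_le_add h4.le hd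
      _ = ε * (1 + L * |y| * |x|) := by simp; ring
  have hz : ‖u x y - (g x y + ∫ s in (0 : ℝ)..x, ∫ t in (0 : ℝ)..y, F s t (u s t))‖ ≤ 0 := by
    refine le_of_forall_pos_le_add fun ε hε => ?_
    have hpos : 0 < 1 + L * |y| * |x| := by positivity
    have := hle (ε / (1 + L * |y| * |x|)) (by positivity)
    rwa [div_mul_cancel₀ _ hpos.ne', ← zero_add ε] at this
  exact sub_eq_zero.1 (norm_le_zero_iff.1 hz)

theorem hasDerivWithinAt_integral_integral_fst [CompleteSpace E] (h₁ : IsBasedInterval D₁)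
    (h₂ : IsBasedInterval D₂) {f : ℝ → ℝ → E}
    (hf : ContinuousOn (fun p : ℝ × ℝ => f p.1 p.2) (D₁ ×ˢ D₂)) {x y : ℝ}
    (hx : x ∈ D₁) (hy : y ∈ D₂) :
    HasDerivWithinAt (fun x' => ∫ s in (0 : ℝ)..x', ∫ t in (0 : ℝ)..y, f s t)
      (∫ t in (0 : ℝ)..y, f x t) D₁ x :=
  h₁.hasDerivWithinAt_integral (continuousOn_left (f := fun s y => ∫ t in (0 : ℝ)..y, f s t)
    (h₁.continuousOn_integral_right h₂ hf) hy) hx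

theorem hasDerivWithinAt_integral_integral_snd [CompleteSpace E] (h₁ : IsBasedInterval D₁)
    (h₂ : IsBasedInterval D₂) {f : ℝ → ℝ → E}
    (hf : ContinuousOn (fun p : ℝ × ℝ => f p.1 p.2) (D₁ ×ˢ D₂)) {x y : ℝ}
    (hx : x ∈ D₁) (hy : y ∈ D₂) :
    HasDerivWithinAt (fun y' => ∫ s in (0 : ℝ)..x, ∫ t in (0 : ℝ)..y', f s t)
      (∫ s in (0 : ℝ)..x, f s y) D₂ y :=
  (h₂.hasDerivWithinAt_integral (continuousOn_right (f := fun x t => ∫ s in (0 : ℝ)..x, f s t)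
    (h₁.continuousOn_integral_left h₂ hf) hx) hy).congr
    (fun _ hy' => h₁.integral_swap h₂ hf hx hy') (h₁.integral_swap h₂ hf hx hy)

end Goursat

/-! ### The sine-Gordon equation -/

/-- The Goursat problem for the sine-Gordon equation `φ_xy = sin φ` has a global smooth solution;
`φ_x` is recorded with its own derivative in `y`. -/
theorem exists_sineGordon {D₁ D₂ : Set ℝ} (h₁ : IsBasedInterval D₁) (h₂ : IsBasedInterval D₂)
    {α β : ℝ → ℝ} (hα : ContDiffOn ℝ ∞ α D₁) (hβ : ContDiffOn ℝ ∞ β D₂) (hα₀ : α 0 = 0) :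
    ∃ φ φx : ℝ → ℝ → ℝ,
      ContDiffOn ℝ ∞ (fun p : ℝ × ℝ => φ p.1 p.2) (D₁ ×ˢ D₂) ∧
      ContDiffOn ℝ ∞ (fun p : ℝ × ℝ => φx p.1 p.2) (D₁ ×ˢ D₂) ∧
      (∀ x ∈ D₁, ∀ y ∈ D₂, HasDerivWithinAt (fun s => φ s y) (φx x y) D₁ x) ∧
      (∀ x ∈ D₁, ∀ y ∈ D₂, HasDerivWithinAt (fun t => φx x t) (Real.sin (φ x y)) D₂ y) ∧
      (∀ x ∈ D₁, φ x 0 = α x + β 0) ∧ (∀ y ∈ D₂, φ 0 y = β y) := by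
  obtain ⟨φ, hφ, heq⟩ := exists_goursat (E := ℝ) h₁ h₂ (g := fun x y => α x + β y)
    (F := fun _ _ u => Real.sin u)
    ((continuousOn_comp_fst hα.continuousOn).add (continuousOn_comp_snd hβ.continuousOn))
    (by fun_prop) (fun a b c d _ _ => ⟨1, zero_le_one, fun s _ t _ u v => by
      rw [one_mul]
      simpa [dist_eq_norm] using Real.lipschitzWith_sin.dist_le_mul u v⟩)
  set α' := derivWithin α D₁ with hα'
  set β' := derivWithin β D₂ with hβ'
  have hα's : ContDiffOn ℝ ∞ α' D₁ := hα.derivWithin h₁.uniqueDiffOn (by simp)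
  have hβ's : ContDiffOn ℝ ∞ β' D₂ := hβ.derivWithin h₂.uniqueDiffOn (by simp)
  have hαd : ∀ x ∈ D₁, HasDerivWithinAt α (α' x) D₁ x := fun x hx =>
    (hα.differentiableOn (by simp) x hx).hasDerivWithinAt
  have hβd : ∀ y ∈ D₂, HasDerivWithinAt β (β' y) D₂ y := fun y hy =>
    (hβ.differentiableOn (by simp) y hy).hasDerivWithinAt
  have hsin : ContinuousOn (fun p : ℝ × ℝ => Real.sin (φ p.1 p.2)) (D₁ ×ˢ D₂) :=
    Real.continuous_sin.comp_continuousOn hφ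
  set φx : ℝ → ℝ → ℝ := fun x y => α' x + ∫ t in (0 : ℝ)..y, Real.sin (φ x t) with hφx
  set φy : ℝ → ℝ → ℝ := fun x y => β' y + ∫ s in (0 : ℝ)..x, Real.sin (φ s y) with hφy
  have hdx : ∀ x ∈ D₁, ∀ y ∈ D₂, HasDerivWithinAt (fun s => φ s y) (φx x y) D₁ x := by
    intro x hx y hy
    exact (((hαd x hx).add_const (β y)).add (hasDerivWithinAt_integral_integral_fst h₁ h₂
      (f := fun s t => Real.sin (φ s t)) hsin hx hy)).congr
      (fun s hs => heq s hs y hy) (heq x hx y hy)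
  have hdy : ∀ x ∈ D₁, ∀ y ∈ D₂, HasDerivWithinAt (fun t => φ x t) (φy x y) D₂ y := by
    intro x hx y hy
    exact (((hβd y hy).const_add (α x)).add (hasDerivWithinAt_integral_integral_snd h₁ h₂
      (f := fun s t => Real.sin (φ s t)) hsin hx hy)).congr
      (fun t ht => heq x hx t ht) (heq x hx y hy)
  have hxs : ∀ n : ℕ, ContDiffOn ℝ n (fun p : ℝ × ℝ => φ p.1 p.2) (D₁ ×ˢ D₂) →
      ContDiffOn ℝ n (fun p : ℝ × ℝ => φx p.1 p.2) (D₁ ×ˢ D₂) := fun n hn =>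
    (contDiffOn_comp_fst (hα's.of_le (by exact_mod_cast le_top))).add
      (h₁.contDiffOn_integral_right h₂ n (f := fun s t => Real.sin (φ s t))
        (Real.contDiff_sin.comp_contDiffOn hn))
  have hys : ∀ n : ℕ, ContDiffOn ℝ n (fun p : ℝ × ℝ => φ p.1 p.2) (D₁ ×ˢ D₂) →
      ContDiffOn ℝ n (fun p : ℝ × ℝ => φy p.1 p.2) (D₁ ×ˢ D₂) := fun n hn =>
    (contDiffOn_comp_snd (hβ's.of_le (by exact_mod_cast le_top))).add
      (h₁.contDiffOn_integral_left h₂ n (f := fun s t => Real.sin (φ s t))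
        (Real.contDiff_sin.comp_contDiffOn hn))
  have hall : ∀ n : ℕ, ContDiffOn ℝ n (fun p : ℝ × ℝ => φ p.1 p.2) (D₁ ×ˢ D₂) := by
    intro n
    induction n with
    | zero => simpa using hφ
    | succ n ih => exact_mod_cast h₁.contDiffOn_of_partials h₂ n hdx hdy (hxs n ih) (hys n ih)
  refine ⟨φ, φx, contDiffOn_infty.2 hall, contDiffOn_infty.2 fun n => hxs n (hall n), hdx, ?_, ?_,
    ?_⟩
  · intro x hx y hy
    exact (h₂.hasDerivWithinAt_integral (continuousOn_right (f := fun s t => Real.sin (φ s t))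
      hsin hx) hy).const_add (α' x)
  · intro x hx
    simpa using heq x hx 0 h₂.zero_mem
  · intro y hy
    simpa [hα₀] using heq 0 h₁.zero_mem y hy

/-! ### Flat connections over a product of intervals -/

section Flat

variable {𝔸 : Type*} [NormedRing 𝔸] [NormedAlgebra ℝ 𝔸] {D₁ D₂ : Set ℝ}

/-- The linear system `P_y = -QA`, `Q_x = -PB` with zero data on the axes has only the zero
solution: iterating the integrated equations bounds `P` by a multiple of `|x|ⁿ / n!`. -/
theorem eq_zero_of_linear_goursat [CompleteSpace 𝔸] (h₁ : IsBasedInterval D₁)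
    (h₂ : IsBasedInterval D₂)
    {P Q A B : ℝ → ℝ → 𝔸}
    (hP : ContinuousOn (fun p : ℝ × ℝ => P p.1 p.2) (D₁ ×ˢ D₂))
    (hQ : ContinuousOn (fun p : ℝ × ℝ => Q p.1 p.2) (D₁ ×ˢ D₂))
    (hA : ContinuousOn (fun p : ℝ × ℝ => A p.1 p.2) (D₁ ×ˢ D₂))
    (hB : ContinuousOn (fun p : ℝ × ℝ => B p.1 p.2) (D₁ ×ˢ D₂))
    (hPy : ∀ x ∈ D₁, ∀ y ∈ D₂, HasDerivWithinAt (fun t => P x t) (-(Q x y * A x y)) D₂ y)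
    (hQx : ∀ x ∈ D₁, ∀ y ∈ D₂, HasDerivWithinAt (fun s => Q s y) (-(P x y * B x y)) D₁ x)
    (hP0 : ∀ x ∈ D₁, P x 0 = 0) (hQ0 : ∀ y ∈ D₂, Q 0 y = 0) {x y : ℝ} (hx : x ∈ D₁)
    (hy : y ∈ D₂) : P x y = 0 ∧ Q x y = 0 := by
  have hcQ : ContinuousOn (fun p : ℝ × ℝ => -(Q p.1 p.2 * A p.1 p.2)) (D₁ ×ˢ D₂) :=
    (hQ.mul hA).neg
  have hcP : ContinuousOn (fun p : ℝ × ℝ => -(P p.1 p.2 * B p.1 p.2)) (D₁ ×ˢ D₂) :=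
    (hP.mul hB).neg
  have hK : IsCompact (uIcc 0 x ×ˢ uIcc 0 y) := isCompact_uIcc.prod isCompact_uIcc
  have hsub : uIcc 0 x ×ˢ uIcc 0 y ⊆ D₁ ×ˢ D₂ :=
    prod_mono (h₁.uIcc_subset hx) (h₂.uIcc_subset hy)
  obtain ⟨a, ha⟩ := hK.exists_bound_of_continuousOn (hA.mono hsub)
  obtain ⟨b, hb⟩ := hK.exists_bound_of_continuousOn (hB.mono hsub)
  obtain ⟨c, hc⟩ := hK.exists_bound_of_continuousOn (hP.mono hsub)
  have h00 : ((0 : ℝ), (0 : ℝ)) ∈ uIcc 0 x ×ˢ uIcc 0 y := ⟨left_mem_uIcc, left_mem_uIcc⟩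
  have ha0 : 0 ≤ a := (norm_nonneg _).trans (ha _ h00)
  have hb0 : 0 ≤ b := (norm_nonneg _).trans (hb _ h00)
  have hc0 : 0 ≤ c := (norm_nonneg _).trans (hc _ h00)
  have hQest : ∀ (K : ℝ) (n : ℕ), 0 ≤ K →
      (∀ s ∈ uIcc 0 x, ∀ t ∈ uIcc 0 y, ‖P s t‖ ≤ K * |s| ^ n) →
      ∀ s ∈ uIcc 0 x, ∀ t ∈ uIcc 0 y, ‖Q s t‖ ≤ K * b * (|s| ^ (n + 1) / (n + 1)) := by
    intro K n hK0 h s hs t ht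
    have hs' := h₁.uIcc_subset hx hs
    have ht' := h₂.uIcc_subset hy ht
    have h3 := h₁.integral_eq_sub (fun r hr => hQx r hr t ht')
      (continuousOn_left (f := fun x y => -(P x y * B x y)) hcP ht') hs'
    rw [hQ0 t ht', sub_zero] at h3
    rw [← h3]
    refine norm_integral_le_of_norm_le_mul_pow n fun r hr => ?_
    have hr' : r ∈ uIcc 0 x :=
      (uIcc_subset_uIcc_left hs) (uIoc_subset_uIcc hr)
    rw [norm_neg]
    calc ‖P r t * B r t‖ ≤ ‖P r t‖ * ‖B r t‖ := norm_mul_le _ _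
      _ ≤ (K * |r| ^ n) * b :=
        mul_le_mul (h r hr' t ht) (hb (r, t) ⟨hr', ht⟩) (norm_nonneg _) (by positivity)
      _ = K * b * |r| ^ n := by ring
  have hPest : ∀ n : ℕ, ∀ s ∈ uIcc 0 x, ∀ t ∈ uIcc 0 y,
      ‖P s t‖ ≤ c * (a * b * |y|) ^ n / n.factorial * |s| ^ n := by
    intro n
    induction n with
    | zero =>
      intro s hs t ht
      simpa using hc (s, t) ⟨hs, ht⟩
    | succ n ih =>
      intro s hs t ht
      have hs' := h₁.uIcc_subset hx hs
      have ht' := h₂.uIcc_subset hy ht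
      have h3 := h₂.integral_eq_sub (fun r hr => hPy s hs' r hr)
        (continuousOn_right (f := fun x y => -(Q x y * A x y)) hcQ hs') ht'
      rw [hP0 s hs', sub_zero] at h3
      rw [← h3]
      set K := c * (a * b * |y|) ^ n / n.factorial with hKdef
      have hK0 : 0 ≤ K := by positivity
      have h4 := intervalIntegral.norm_integral_le_of_norm_le_const (a := 0) (b := t)
        (f := fun r => -(Q s r * A s r)) (C := K * b * (|s| ^ (n + 1) / (n + 1)) * a) (by
          intro r hr
          have hr' : r ∈ uIcc 0 y := (uIcc_subset_uIcc_left ht) (uIoc_subset_uIcc hr)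
          rw [norm_neg]
          exact (norm_mul_le _ _).trans (mul_le_mul (hQest K n hK0 ih s hs r hr')
            (ha (s, r) ⟨hs, hr'⟩) (norm_nonneg _) (by positivity)))
      have ht1 : |t - 0| ≤ |y| := by
        have := abs_sub_left_of_mem_uIcc ht
        simpa using this
      refine h4.trans ?_
      rw [Nat.factorial_succ]
      push_cast
      have hn : (0 : ℝ) < n + 1 := by positivity
      have hnf : (0 : ℝ) < n.factorial := by positivity
      calc K * b * (|s| ^ (n + 1) / (n + 1)) * a * |t - 0|
          ≤ K * b * (|s| ^ (n + 1) / (n + 1)) * a * |y| := by gcongr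
        _ = c * (a * b * |y|) ^ (n + 1) / ((n + 1) * n.factorial) * |s| ^ (n + 1) := by
          rw [hKdef]
          field_simp
          ring
  have hPz : ∀ s ∈ uIcc 0 x, ∀ t ∈ uIcc 0 y, P s t = 0 := by
    intro s hs t ht
    have hlim : Tendsto (fun n : ℕ => c * ((a * b * |y| * |s|) ^ n / n.factorial)) atTop
        (𝓝 (c * 0)) := (FloorSemiring.tendsto_pow_div_factorial_atTop _).const_mul c
    rw [mul_zero] at hlim
    refine norm_le_zero_iff.1 (ge_of_tendsto' hlim fun n => ?_)
    refine (hPest n s hs t ht).trans (le_of_eq ?_)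
    rw [mul_pow (a * b * |y|)]
    ring
  refine ⟨hPz x right_mem_uIcc y right_mem_uIcc, ?_⟩
  have := hQest 0 0 le_rfl (fun s hs t ht => by simp [hPz s hs t ht]) x right_mem_uIcc y
    right_mem_uIcc
  simpa using this

/-- A connection `A dx + B dy` with `A_y - B_x = [A, B]` on a product of intervals has a frame
`U`, `U_x = UA`, `U_y = UB`, with given values on the axes. It is found as the solution of the
Goursat problem `U_xy = U(BA + A_y)`; the defects `U_x - UA` and `U_y - UB` then satisfy a linear
Goursat system with zero data. -/
theorem exists_flat_frame [CompleteSpace 𝔸] (h₁ : IsBasedInterval D₁)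
    (h₂ : IsBasedInterval D₂)
    {A B Ay Bx : ℝ → ℝ → 𝔸} {a b : ℝ → 𝔸}
    (hA : ContinuousOn (fun p : ℝ × ℝ => A p.1 p.2) (D₁ ×ˢ D₂))
    (hB : ContinuousOn (fun p : ℝ × ℝ => B p.1 p.2) (D₁ ×ˢ D₂))
    (hAy : ContinuousOn (fun p : ℝ × ℝ => Ay p.1 p.2) (D₁ ×ˢ D₂))
    (hdA : ∀ x ∈ D₁, ∀ y ∈ D₂, HasDerivWithinAt (fun t => A x t) (Ay x y) D₂ y)
    (hdB : ∀ x ∈ D₁, ∀ y ∈ D₂, HasDerivWithinAt (fun s => B s y) (Bx x y) D₁ x)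
    (hflat : ∀ x ∈ D₁, ∀ y ∈ D₂, Ay x y - Bx x y = A x y * B x y - B x y * A x y)
    (ha : ∀ x ∈ D₁, HasDerivWithinAt a (a x * A x 0) D₁ x)
    (hb : ∀ y ∈ D₂, HasDerivWithinAt b (b y * B 0 y) D₂ y) (ha0 : a 0 = 1) (hb0 : b 0 = 1) :
    ∃ U : ℝ → ℝ → 𝔸, ContinuousOn (fun p : ℝ × ℝ => U p.1 p.2) (D₁ ×ˢ D₂) ∧
      (∀ x ∈ D₁, ∀ y ∈ D₂, HasDerivWithinAt (fun s => U s y) (U x y * A x y) D₁ x) ∧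
      (∀ x ∈ D₁, ∀ y ∈ D₂, HasDerivWithinAt (fun t => U x t) (U x y * B x y) D₂ y) ∧
      (∀ x ∈ D₁, U x 0 = a x) ∧ ∀ y ∈ D₂, U 0 y = b y := by
  have hac : ContinuousOn a D₁ := fun x hx => (ha x hx).continuousWithinAt
  have hbc : ContinuousOn b D₂ := fun y hy => (hb y hy).continuousWithinAt
  set M : ℝ → ℝ → 𝔸 := fun x y => B x y * A x y + Ay x y with hM
  have hMc : ContinuousOn (fun p : ℝ × ℝ => M p.1 p.2) (D₁ ×ˢ D₂) := (hB.mul hA).add hAy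
  obtain ⟨U, hU, heq⟩ := exists_goursat h₁ h₂ (g := fun x y => a x + b y - 1)
    (F := fun x y u => u * M x y)
    (((continuousOn_comp_fst hac).add (continuousOn_comp_snd hbc)).sub continuousOn_const)
    (continuousOn_snd.mul (hMc.comp continuousOn_fst fun q hq => hq.1)) (by
      intro a b c d hs hs'
      obtain ⟨L, hL⟩ := (isCompact_Icc.prod isCompact_Icc).exists_bound_of_continuousOn
        (hMc.mono (prod_mono hs hs'))
      refine ⟨max L 0, le_max_right _ _, fun s hs t ht u v => ?_⟩
      rw [← sub_mul, mul_comm (max L 0)]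
      exact (norm_mul_le _ _).trans (mul_le_mul_of_nonneg_left
        ((hL (s, t) ⟨hs, ht⟩).trans (le_max_left _ _)) (norm_nonneg _)))
  have hUM : ContinuousOn (fun p : ℝ × ℝ => U p.1 p.2 * M p.1 p.2) (D₁ ×ˢ D₂) := hU.mul hMc
  have hUa : ∀ x ∈ D₁, U x 0 = a x := fun x hx => by simpa [hb0] using heq x hx 0 h₂.zero_mem
  have hUb : ∀ y ∈ D₂, U 0 y = b y := fun y hy => by simpa [ha0] using heq 0 h₁.zero_mem y hy
  set Ux : ℝ → ℝ → 𝔸 := fun x y => a x * A x 0 + ∫ t in (0 : ℝ)..y, U x t * M x t with hUx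
  set Uy : ℝ → ℝ → 𝔸 := fun x y => b y * B 0 y + ∫ s in (0 : ℝ)..x, U s y * M s y with hUy
  have hdx : ∀ x ∈ D₁, ∀ y ∈ D₂, HasDerivWithinAt (fun s => U s y) (Ux x y) D₁ x := by
    intro x hx y hy
    exact ((((ha x hx).add_const (b y)).sub_const 1).add
      (hasDerivWithinAt_integral_integral_fst h₁ h₂
        (f := fun s t => U s t * M s t) hUM hx hy)).congr
      (fun s hs => heq s hs y hy) (heq x hx y hy)
  have hdy : ∀ x ∈ D₁, ∀ y ∈ D₂, HasDerivWithinAt (fun t => U x t) (Uy x y) D₂ y := by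
    intro x hx y hy
    exact ((((hb y hy).const_add (a x)).sub_const 1).add
      (hasDerivWithinAt_integral_integral_snd h₁ h₂
        (f := fun s t => U s t * M s t) hUM hx hy)).congr
      (fun t ht => heq x hx t ht) (heq x hx y hy)
  have hUxc : ContinuousOn (fun p : ℝ × ℝ => Ux p.1 p.2) (D₁ ×ˢ D₂) :=
    (continuousOn_comp_fst (hac.mul (continuousOn_left hA h₂.zero_mem))).add
      (h₁.continuousOn_integral_right h₂ (f := fun s t => U s t * M s t) hUM)
  have hUyc : ContinuousOn (fun p : ℝ × ℝ => Uy p.1 p.2) (D₁ ×ˢ D₂) :=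
    (continuousOn_comp_snd (hbc.mul (continuousOn_right hB h₁.zero_mem))).add
      (h₁.continuousOn_integral_left h₂ (f := fun s t => U s t * M s t) hUM)
  have hzero : ∀ x ∈ D₁, ∀ y ∈ D₂, Ux x y - U x y * A x y = 0 ∧ Uy x y - U x y * B x y = 0 := by
    intro x hx y hy
    refine eq_zero_of_linear_goursat h₁ h₂ (P := fun x y => Ux x y - U x y * A x y)
      (Q := fun x y => Uy x y - U x y * B x y) (hUxc.sub (hU.mul hA)) (hUyc.sub (hU.mul hB)) hA hB
      (fun x hx y hy => ?_) (fun x hx y hy => ?_) (fun x hx => ?_) (fun y hy => ?_) hx hy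
    · have h := ((h₂.hasDerivWithinAt_integral (continuousOn_right
        (f := fun s t => U s t * M s t) hUM hx) hy).const_add (a x * A x 0)).fun_sub
        ((hdy x hx y hy).mul (hdA x hx y hy))
      refine h.congr_deriv ?_
      simp only [hM]
      noncomm_ring
    · have h := ((h₁.hasDerivWithinAt_integral (continuousOn_left
        (f := fun s t => U s t * M s t) hUM hy) hx).const_add (b y * B 0 y)).fun_sub
        ((hdx x hx y hy).mul (hdB x hx y hy))
      refine h.congr_deriv ?_
      have hM' : M x y = A x y * B x y + Bx x y := by
        have := hflat x hx y hy
        simp only [hM]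
        rw [sub_eq_iff_eq_add] at this
        rw [this]
        abel
      rw [hM']
      noncomm_ring
    · simp [hUx, hUa x hx]
    · simp [hUy, hUb y hy]
  refine ⟨U, hU, fun x hx y hy => ?_, fun x hx y hy => ?_, hUa, hUb⟩
  · rw [← sub_eq_zero.1 (hzero x hx y hy).1]
    exact hdx x hx y hy
  · rw [← sub_eq_zero.1 (hzero x hx y hy).2]
    exact hdy x hx y hy

/-- A continuous frame of a smooth connection is smooth. -/
theorem contDiffOn_frame (h₁ : IsBasedInterval D₁) (h₂ : IsBasedInterval D₂)
    {U A B : ℝ → ℝ → 𝔸} (hU : ContinuousOn (fun p : ℝ × ℝ => U p.1 p.2) (D₁ ×ˢ D₂))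
    (hA : ContDiffOn ℝ ∞ (fun p : ℝ × ℝ => A p.1 p.2) (D₁ ×ˢ D₂))
    (hB : ContDiffOn ℝ ∞ (fun p : ℝ × ℝ => B p.1 p.2) (D₁ ×ˢ D₂))
    (hdx : ∀ x ∈ D₁, ∀ y ∈ D₂, HasDerivWithinAt (fun s => U s y) (U x y * A x y) D₁ x)
    (hdy : ∀ x ∈ D₁, ∀ y ∈ D₂, HasDerivWithinAt (fun t => U x t) (U x y * B x y) D₂ y) :
    ContDiffOn ℝ ∞ (fun p : ℝ × ℝ => U p.1 p.2) (D₁ ×ˢ D₂) := by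
  refine contDiffOn_infty.2 fun n => ?_
  induction n with
  | zero => simpa using hU
  | succ n ih =>
    exact_mod_cast h₁.contDiffOn_of_partials h₂ n hdx hdy
      (ih.mul (hA.of_le (by exact_mod_cast le_top))) (ih.mul (hB.of_le (by exact_mod_cast le_top)))

end Flat

/-! ### Linear equations with values in `su(2)` -/

section Frames

attribute [local instance] Matrix.linftyOpNormedRing Matrix.linftyOpNormedAlgebra

theorem matHasDerivWithinAt_iff {F : ℝ → Mat} {F' : Mat} {S : Set ℝ} {t : ℝ} :
    MatHasDerivWithinAt F F' S t ↔ HasDerivWithinAt F F' S t :=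
  ⟨fun h => hasDerivWithinAt_pi.2 fun i => hasDerivWithinAt_pi.2 fun j => h i j,
    fun h i j => hasDerivWithinAt_pi.1 (hasDerivWithinAt_pi.1 h i) j⟩

theorem contDiffOn_mat_iff {X : Type*} [NormedAddCommGroup X] [NormedSpace ℝ X] {F : X → Mat}
    {S : Set X} {n : ℕ∞ω} :
    ContDiffOn ℝ n F S ↔ ∀ i j, ContDiffOn ℝ n (fun x => F x i j) S := by
  let e : Mat ≃L[ℝ] (Fin 2 → Fin 2 → ℂ) :=
    (LinearEquiv.refl ℝ (Fin 2 → Fin 2 → ℂ) : Mat ≃ₗ[ℝ] (Fin 2 → Fin 2 → ℂ)).toContinuousLinearEquiv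
  have h : ContDiffOn ℝ n F S ↔ ContDiffOn ℝ n (fun x i j => F x i j) S :=
    (e.comp_contDiffOn_iff (f := F)).symm
  rw [h, contDiffOn_pi]
  exact forall_congr' fun i => contDiffOn_pi

variable {D : Set ℝ}

/-- If `W' = Wη` and `E' = Eη` with `η` skew-Hermitian, then `W E*` is constant. -/
theorem mul_star_eq_of_ode (hD : IsBasedInterval D) {W E η : ℝ → Mat}
    (hW : ∀ t ∈ D, HasDerivWithinAt W (W t * η t) D t)
    (hE : ∀ t ∈ D, HasDerivWithinAt E (E t * η t) D t)
    (hη : ∀ t ∈ D, star (η t) = -η t) {t : ℝ} (ht : t ∈ D) :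
    W t * star (E t) = W 0 * star (E 0) := by
  have hd : ∀ s ∈ D, HasDerivWithinAt (fun s => W s * star (E s)) 0 D s := by
    intro s hs
    have hstar : HasDerivWithinAt (fun s => star (E s)) (star (E s * η s)) D s :=
      matHasDerivWithinAt_iff.1 fun i j => (matHasDerivWithinAt_iff.2 (hE s hs) j i).star
    refine ((hW s hs).mul hstar).congr_deriv ?_
    rw [star_mul, hη s hs]
    noncomm_ring
  have := hD.convex.norm_image_sub_le_of_norm_hasDerivWithin_le (C := 0) hd (by simp)
    hD.zero_mem ht
  rw [zero_mul, norm_le_zero_iff, sub_eq_zero] at this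
  exact this

/-- The equation `W' = Wη` with `η` skew-Hermitian and traceless preserves `SU(2)`. -/
theorem mem_SU2_of_ode (hD : IsBasedInterval D) {W η : ℝ → Mat}
    (hW : ∀ t ∈ D, HasDerivWithinAt W (W t * η t) D t)
    (hη : ∀ t ∈ D, star (η t) = -η t) (htr : ∀ t ∈ D, η t 0 0 + η t 1 1 = 0)
    (h0 : W 0 ∈ Matrix.specialUnitaryGroup (Fin 2) ℂ) {t : ℝ} (ht : t ∈ D) :
    W t ∈ Matrix.specialUnitaryGroup (Fin 2) ℂ := by
  rw [Matrix.mem_specialUnitaryGroup_iff, Matrix.mem_unitaryGroup_iff] at h0 ⊢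
  refine ⟨(mul_star_eq_of_ode hD hW hW hη ht).trans h0.1, ?_⟩
  have hd : ∀ s ∈ D, HasDerivWithinAt (fun s => (W s).det) 0 D s := by
    intro s hs
    have h := matHasDerivWithinAt_iff.2 (hW s hs)
    have h2 := ((h 0 0).mul (h 1 1)).fun_sub ((h 0 1).mul (h 1 0))
    have h3 : (fun s => (W s).det) = fun s => W s 0 0 * W s 1 1 - W s 0 1 * W s 1 0 := by
      funext s
      rw [Matrix.det_fin_two]
    rw [h3]
    refine h2.congr_deriv ?_
    simp only [Matrix.mul_apply, Fin.sum_univ_two]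
    linear_combination (W s 0 0 * W s 1 1 - W s 0 1 * W s 1 0) * htr s hs
  have := hD.convex.norm_image_sub_le_of_norm_hasDerivWithin_le (C := 0) hd (by simp)
    hD.zero_mem ht
  rw [zero_mul, norm_le_zero_iff, sub_eq_zero] at this
  exact this.trans h0.2

/-- Solutions of `W' = Wη`, `η` skew-Hermitian, are determined by their value at `0`, provided one
of them is unitary. -/
theorem eq_of_ode (hD : IsBasedInterval D) {W E η : ℝ → Mat}
    (hW : ∀ t ∈ D, HasDerivWithinAt W (W t * η t) D t)
    (hE : ∀ t ∈ D, HasDerivWithinAt E (E t * η t) D t)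
    (hη : ∀ t ∈ D, star (η t) = -η t) (h0 : W 0 = E 0)
    (hE0 : E 0 * star (E 0) = 1) {t : ℝ} (ht : t ∈ D) : W t = E t := by
  have h1 := mul_star_eq_of_ode hD hW hE hη ht
  have h2 := (mul_star_eq_of_ode hD hE hE hη ht).trans hE0
  have h3 : star (E t) * E t = 1 := mul_eq_one_comm.1 h2
  calc W t = W t * (star (E t) * E t) := by rw [h3, mul_one]
    _ = W 0 * star (E 0) * E t := by rw [← mul_assoc, h1]
    _ = E t := by rw [h0, hE0, one_mul]

/-! ### The frame of a normalized potential as a power series in the loop parameter -/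

/-- The matrix `(i/2) [[0, e^{-iθ}], [e^{iθ}, 0]]`; the normalized potentials are
`η₊ = λ N(α)` and `η₋ = -λ⁻¹ N(-β)`. -/
def angleMat (θ : ℝ) : Mat :=
  (Complex.I / 2) • !![0, Complex.exp (-(Complex.I * θ)); Complex.exp (Complex.I * θ), 0]

theorem etaPlus_eq (α : ℝ → ℝ) (x : ℝ) (l : ℝˣ) :
    etaPlus α x l = toC l • angleMat (α x) := by
  rw [etaPlus, angleMat, smul_smul, mul_comm]

theorem etaMinus_eq (β : ℝ → ℝ) (y : ℝ) (l : ℝˣ) :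
    etaMinus β y l = (-(toC l)⁻¹) • angleMat (-β y) := by
  rw [etaMinus, angleMat, smul_smul]
  congr 1
  · have : toC l ≠ 0 := by simp [toC]
    field_simp
  · simp

theorem star_angleMat (θ : ℝ) : star (angleMat θ) = -angleMat θ := by
  ext i j
  fin_cases i <;> fin_cases j <;>
    simp [angleMat, Matrix.star_apply, ← Complex.exp_conj, neg_div]

theorem sigma3_mul_angleMat (θ : ℝ) : sigma3 * angleMat θ * sigma3 = -angleMat θ := by
  ext i j
  fin_cases i <;> fin_cases j <;> simp [angleMat, sigma3, Matrix.mul_apply, Fin.sum_univ_two]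

theorem sigma3_mul_self : sigma3 * sigma3 = 1 := by
  ext i j
  fin_cases i <;> fin_cases j <;> simp [sigma3, Matrix.mul_apply, Fin.sum_univ_two]

theorem sigma3_inv : sigma3⁻¹ = sigma3 := Matrix.inv_eq_left_inv sigma3_mul_self

theorem contDiff_angleMat : ContDiff ℝ ∞ angleMat := by
  rw [← contDiffOn_univ, contDiffOn_mat_iff]
  have h : ContDiff ℝ ∞ fun θ : ℝ => (θ : ℂ) := Complex.ofRealCLM.contDiff
  intro i j
  rw [contDiffOn_univ]
  fin_cases i <;> fin_cases j <;> simp [angleMat] <;> fun_prop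

theorem norm_angleMat_le (θ : ℝ) : ‖angleMat θ‖ ≤ 1 / 2 := by
  have h1 : ‖Complex.exp (Complex.I * θ)‖ = 1 := by
    rw [mul_comm]; exact Complex.norm_exp_ofReal_mul_I θ
  have h2 : ‖Complex.exp (-(Complex.I * θ))‖ = 1 := by
    have := Complex.norm_exp_ofReal_mul_I (-θ)
    rwa [Complex.ofReal_neg, neg_mul, mul_comm] at this
  rw [Matrix.linfty_opNorm_def]
  have : ∀ i, ∑ j, ‖angleMat θ i j‖ = 1 / 2 := by
    intro i
    fin_cases i <;> simp [angleMat, Fin.sum_univ_two, h1, h2]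
  rw [show (1 / 2 : ℝ) = ((1 / 2 : NNReal) : ℝ) by simp]
  rw [NNReal.coe_le_coe]
  refine Finset.sup_le fun i _ => ?_
  rw [← NNReal.coe_le_coe]
  push_cast
  exact (this i).le

/-- The coefficients of the frame: `c₀ = I` and `c_{k+1}(t) = ∫₀ᵗ c_k N(θ)`. -/
def frameCoeff (θ : ℝ → ℝ) : ℕ → ℝ → Mat
  | 0 => fun _ => 1
  | k + 1 => fun t => ∫ s in (0 : ℝ)..t, frameCoeff θ k s * angleMat (θ s)

/-- The solution `W = ∑ zᵏ c_k` of `W' = z W N(θ)`, `W(0) = I`. -/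
def frame (θ : ℝ → ℝ) (t : ℝ) (z : ℂ) : Mat := ∑' k : ℕ, z ^ k • frameCoeff θ k t

variable {θ : ℝ → ℝ}

theorem continuousOn_frameCoeff (hD : IsBasedInterval D) (hθ : ContinuousOn θ D) (k : ℕ) :
    ContinuousOn (frameCoeff θ k) D := by
  induction k with
  | zero => exact continuousOn_const
  | succ k ih =>
    intro t ht
    exact (hD.hasDerivWithinAt_integral
      (ih.mul (contDiff_angleMat.continuous.comp_continuousOn hθ)) ht).continuousWithinAt

theorem norm_frameCoeff_le (hD : IsBasedInterval D) (k : ℕ) {t : ℝ} (ht : t ∈ D) :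
    ‖frameCoeff θ k t‖ ≤ (1 / 2) ^ k / k.factorial * |t| ^ k := by
  induction k generalizing t with
  | zero => simp [frameCoeff]
  | succ k ih =>
    have h := norm_integral_le_of_norm_le_mul_pow (x := t)
      (f := fun s => frameCoeff θ k s * angleMat (θ s)) (K := (1 / 2) ^ k / k.factorial * (1 / 2)) k
      (by
        intro s hs
        calc _ ≤ ‖frameCoeff θ k s‖ * ‖angleMat (θ s)‖ := norm_mul_le _ _
          _ ≤ ((1 / 2) ^ k / k.factorial * |s| ^ k) * (1 / 2) :=
            mul_le_mul (ih (hD.uIoc_subset ht hs)) (norm_angleMat_le _) (norm_nonneg _)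
              (by positivity)
          _ = _ := by ring)
    refine h.trans (le_of_eq ?_)
    rw [Nat.factorial_succ]
    push_cast
    have hn : (0 : ℝ) < k + 1 := by positivity
    have hnf : (0 : ℝ) < k.factorial := by positivity
    field_simp
    ring

theorem norm_pow_smul_frameCoeff_le (hD : IsBasedInterval D) (k : ℕ) {t : ℝ} (ht : t ∈ D)
    (z : ℂ) : ‖z ^ k • frameCoeff θ k t‖ ≤ (‖z‖ * (1 / 2) * |t|) ^ k / k.factorial := by
  rw [norm_smul, norm_pow, mul_pow, mul_pow]
  have := mul_le_mul_of_nonneg_left (norm_frameCoeff_le (θ := θ) hD k ht)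
    (pow_nonneg (norm_nonneg z) k)
  calc _ ≤ _ := this
    _ = _ := by ring

theorem hasSum_frame (hD : IsBasedInterval D) {t : ℝ} (ht : t ∈ D) (z : ℂ) :
    HasSum (fun k : ℕ => z ^ k • frameCoeff θ k t) (frame θ t z) :=
  (Summable.of_norm_bounded (Real.summable_pow_div_factorial _) fun k =>
    norm_pow_smul_frameCoeff_le hD k ht z).hasSum

theorem frameCoeff_zero_right (k : ℕ) : frameCoeff θ k 0 = if k = 0 then 1 else 0 := by
  cases k <;> simp [frameCoeff]

theorem frame_zero (z : ℂ) : frame θ 0 z = 1 := by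
  rw [frame, tsum_eq_single 0]
  · simp [frameCoeff]
  · intro k hk
    simp [frameCoeff_zero_right, hk]

theorem continuousOn_frame (hD : IsBasedInterval D) (hθ : ContinuousOn θ D) (z : ℂ) :
    ContinuousOn (fun t => frame θ t z) D := by
  intro t ht
  obtain ⟨a, b, hab, h0, htab, hsub, hn⟩ := hD.exists_Icc ht
  have h : ContinuousOn (fun t => frame θ t z) (Icc a b) := by
    refine continuousOn_tsum (u := fun k => (‖z‖ * (1 / 2) * max |a| |b|) ^ k / k.factorial)
      (fun k => ((continuousOn_frameCoeff hD hθ k).mono hsub).const_smul (z ^ k))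
      (Real.summable_pow_div_factorial _) fun k s hs => ?_
    refine (norm_pow_smul_frameCoeff_le hD k (hsub hs) z).trans ?_
    have : |s| ≤ max |a| |b| := abs_le_max_abs_abs hs.1 hs.2
    gcongr
  exact (h t htab).mono_of_mem_nhdsWithin hn

theorem frame_eq_integral (hD : IsBasedInterval D) (hθ : ContinuousOn θ D) (z : ℂ) {t : ℝ}
    (ht : t ∈ D) :
    frame θ t z = 1 + ∫ s in (0 : ℝ)..t, frame θ s z * (z • angleMat (θ s)) := by
  have hN := contDiff_angleMat.continuous.comp_continuousOn hθ
  -- the matrix topology is the product topology, which instance search does not see here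
  have : TopologicalSpace.PseudoMetrizableSpace Mat :=
    inferInstanceAs (TopologicalSpace.PseudoMetrizableSpace (Fin 2 → Fin 2 → ℂ))
  set C : ℝ := ‖z‖ * (1 / 2) * |t| with hC
  have hsum := intervalIntegral.hasSum_integral_of_dominated_convergence (μ := volume) (a := 0)
    (b := t) (F := fun k s => (z ^ k • frameCoeff θ k s) * (z • angleMat (θ s)))
    (f := fun s => frame θ s z * (z • angleMat (θ s)))
    (fun k _ => C ^ k / k.factorial * (‖z‖ * (1 / 2)))
    (fun k => ((((continuousOn_frameCoeff hD hθ k).const_smul (z ^ k)).mul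
      (hN.const_smul z)).mono (hD.uIoc_subset ht)).aestronglyMeasurable measurableSet_uIoc)
    (fun k => ae_of_all _ fun s hs => by
      have hs1 : |s| ≤ |t| := by
        have := abs_sub_left_of_mem_uIcc (uIoc_subset_uIcc hs)
        simpa using this
      refine (norm_mul_le _ _).trans (mul_le_mul ?_ ?_ (norm_nonneg _) (by positivity))
      · refine (norm_pow_smul_frameCoeff_le hD k (hD.uIoc_subset ht hs) z).trans ?_
        rw [hC]
        gcongr
      · rw [norm_smul]
        exact mul_le_mul_of_nonneg_left (norm_angleMat_le _) (norm_nonneg _))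
    (ae_of_all _ fun s _ => (Real.summable_pow_div_factorial C).mul_right _)
    intervalIntegrable_const
    (ae_of_all _ fun s hs => (hasSum_frame hD (hD.uIoc_subset ht hs) z).mul_right _)
  have hterm : ∀ k : ℕ, ∫ s in (0 : ℝ)..t, (z ^ k • frameCoeff θ k s) * (z • angleMat (θ s))
      = z ^ (k + 1) • frameCoeff θ (k + 1) t := by
    intro k
    rw [frameCoeff, ← intervalIntegral.integral_smul]
    refine intervalIntegral.integral_congr fun s _ => ?_
    simp only [smul_mul_smul_comm, pow_succ]
  simp only [hterm] at hsum
  have h2 := hasSum_frame (θ := θ) hD ht z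
  have h3 := (hasSum_nat_add_iff' (f := fun k : ℕ => z ^ k • frameCoeff θ k t) 1).2 h2
  have h4 := h3.unique hsum
  rw [← h4]
  simp [frameCoeff]

theorem hasDerivWithinAt_frame (hD : IsBasedInterval D) (hθ : ContinuousOn θ D) (z : ℂ) {t : ℝ}
    (ht : t ∈ D) :
    HasDerivWithinAt (fun s => frame θ s z) (frame θ t z * (z • angleMat (θ t))) D t := by
  have hN := contDiff_angleMat.continuous.comp_continuousOn hθ
  exact ((hD.hasDerivWithinAt_integral ((continuousOn_frame hD hθ z).mul (hN.const_smul z))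
    ht).const_add 1).congr (fun s hs => frame_eq_integral hD hθ z hs) (frame_eq_integral hD hθ z ht)

theorem star_smul_angleMat (r θ : ℝ) :
    star ((r : ℂ) • angleMat θ) = -((r : ℂ) • angleMat θ) := by
  rw [star_smul, star_angleMat]
  simp

theorem frame_mem_SU2 (hD : IsBasedInterval D) (hθ : ContinuousOn θ D) (r : ℝ) {t : ℝ}
    (ht : t ∈ D) : frame θ t r ∈ Matrix.specialUnitaryGroup (Fin 2) ℂ := by
  refine mem_SU2_of_ode (W := fun t => frame θ t r) hD
    (fun t ht => hasDerivWithinAt_frame hD hθ r ht)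
    (fun t _ => star_smul_angleMat r (θ t)) (fun t _ => ?_) ?_ ht
  · simp [angleMat]
  · simp only [frame_zero]
    exact one_mem _

/-- The frame is twisted, since `σ₃ N σ₃ = -N`. -/
theorem frame_neg (hD : IsBasedInterval D) (hθ : ContinuousOn θ D) (r : ℝ) {t : ℝ} (ht : t ∈ D) :
    frame θ t (-r) = sigma3 * frame θ t r * sigma3 := by
  have hc : (-(r : ℂ)) = ((-r : ℝ) : ℂ) := by push_cast; rfl
  refine (eq_of_ode (W := fun t => sigma3 * frame θ t r * sigma3) hD (fun t ht => ?_)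
    (fun t ht => hasDerivWithinAt_frame hD hθ _ ht) (fun t _ => ?_) ?_ ?_ ht).symm
  · refine (((hasDerivWithinAt_frame hD hθ r ht).const_mul sigma3).mul_const sigma3).congr_deriv ?_
    have h : (-(r : ℂ)) • angleMat (θ t) = sigma3 * ((r : ℂ) • angleMat (θ t)) * sigma3 := by
      rw [mul_smul_comm, smul_mul_assoc, sigma3_mul_angleMat, smul_neg, neg_smul]
    rw [h]
    have h2 := sigma3_mul_self
    calc _ = sigma3 * frame θ t r * 1 * ((r : ℂ) • angleMat (θ t)) * sigma3 := by noncomm_ring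
      _ = _ := by rw [← h2]; noncomm_ring
  · rw [hc]; exact star_smul_angleMat _ _
  · simp [frame_zero, sigma3_mul_self]
  · simp [frame_zero]

end Frames

/-! ### Expansions in the loop parameter and uniqueness of the Birkhoff decomposition -/

section Birkhoff

theorem toC_ne_zero (l : ℝˣ) : toC l ≠ 0 := by simp [toC]

theorem toC_neg (l : ℝˣ) : toC (-l) = -toC l := by simp [toC]

theorem toC_inv (l : ℝˣ) : toC l⁻¹ = (toC l)⁻¹ := by simp [toC]

/-- A power series converging at all nonzero real points is entire. -/
theorem differentiable_tsum_of_summable {c : ℕ → ℂ}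
    (h : ∀ l : ℝˣ, Summable fun k : ℕ => toC l ^ k * c k) :
    Differentiable ℂ fun z : ℂ => ∑' k : ℕ, z ^ k * c k := by
  intro z
  set r : ℝ := ‖z‖ + 1 with hr
  have hr0 : 0 < r := by positivity
  -- convergence at `2r` bounds the terms on the ball of radius `r` by a geometric series
  obtain ⟨C, hC⟩ := (h (Units.mk0 (2 * r) (by positivity))).tendsto_atTop_zero.norm.bddAbove_range
  have hC' : ∀ k : ℕ, (2 * r) ^ k * ‖c k‖ ≤ C := by
    intro k
    have := hC ⟨k, rfl⟩
    simpa [toC, abs_of_pos hr0, mul_pow] using this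
  have hd := Complex.differentiableOn_tsum_of_summable_norm (u := fun k : ℕ => C * (1 / 2) ^ k)
    (F := fun (k : ℕ) (w : ℂ) => w ^ k * c k) (U := Metric.ball 0 r)
    ((summable_geometric_of_lt_one (by norm_num) (by norm_num)).mul_left C)
    (fun k => by fun_prop) Metric.isOpen_ball (by
      intro k w hw
      have hw' : ‖w‖ ≤ r := by simpa using (mem_ball_zero_iff.1 hw).le
      rw [norm_mul, norm_pow]
      have h1 : ‖w‖ ^ k * ‖c k‖ ≤ r ^ k * ‖c k‖ := by gcongr
      have h2 : r ^ k * ‖c k‖ = ((2 * r) ^ k * ‖c k‖) * (1 / 2) ^ k := by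
        rw [mul_pow, one_div, inv_pow]
        field_simp
      rw [h2] at h1
      exact h1.trans (mul_le_mul_of_nonneg_right (hC' k) (by positivity)))
  exact hd.differentiableAt (Metric.isOpen_ball.mem_nhds (by simp [hr]))

theorem exists_entire_of_hasPosExpansion {g : Loop} {c : ℕ → Mat} (h : HasPosExpansion g c) :
    ∃ G : ℂ → Mat, (∀ i j, Differentiable ℂ fun z => G z i j) ∧ G 0 = c 0 ∧
      ∀ l : ℝˣ, G (toC l) = (g l : Mat) := by
  have hs : ∀ (l : ℝˣ) (i j : Fin 2), HasSum (fun k : ℕ => toC l ^ k * c k i j) ((g l : Mat) i j) :=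
    fun l i j => Pi.hasSum.1 (Pi.hasSum.1 (h l) i) j
  refine ⟨fun z => Matrix.of fun i j => ∑' k : ℕ, z ^ k * c k i j, fun i j => ?_, ?_, fun l => ?_⟩
  · exact differentiable_tsum_of_summable fun l => (hs l i j).summable
  · ext i j
    simp only [Matrix.of_apply]
    rw [tsum_eq_single 0 (fun k hk => by simp [hk])]
    simp
  · ext i j
    exact (hs l i j).tsum_eq

theorem exists_entire_of_hasNegExpansion {g : Loop} {c : ℕ → Mat} (h : HasNegExpansion g c) :
    ∃ G : ℂ → Mat, (∀ i j, Differentiable ℂ fun z => G z i j) ∧ G 0 = c 0 ∧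
      ∀ l : ℝˣ, G (toC l)⁻¹ = (g l : Mat) := by
  obtain ⟨G, hG, h0, hl⟩ := exists_entire_of_hasPosExpansion (g := fun l => g l⁻¹) (c := c)
    fun l => by simpa [toC_inv] using h l⁻¹
  exact ⟨G, hG, h0, fun l => by simpa [toC_inv] using hl l⁻¹⟩

theorem mem_analyticLoops_of_pos {g : Loop} {c : ℕ → Mat} (hg : g ∈ twistedLoops)
    (h : HasPosExpansion g c) : g ∈ analyticLoops := by
  obtain ⟨G, hG, -, hl⟩ := exists_entire_of_hasPosExpansion h
  exact ⟨hg, G, fun i j => (hG i j).differentiableOn, hl⟩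

theorem mem_analyticLoops_of_neg {g : Loop} {c : ℕ → Mat} (hg : g ∈ twistedLoops)
    (h : HasNegExpansion g c) : g ∈ analyticLoops := by
  obtain ⟨G, hG, -, hl⟩ := exists_entire_of_hasNegExpansion h
  refine ⟨hg, fun z => G z⁻¹, fun i j => ?_, hl⟩
  exact (hG i j).comp_differentiableOn (differentiableOn_inv.mono fun z hz => hz)

/-- If `f(λ) = g(1/λ)` for nonzero real `λ` and `f`, `g` are entire, then both are constant: by the
identity theorem the relation persists on `ℂ^*`, hence `f` is bounded. -/
theorem eq_of_entire_of_inv {f g : ℂ → ℂ} (hf : Differentiable ℂ f) (hg : Differentiable ℂ g)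
    (h : ∀ l : ℝˣ, f (toC l) = g (toC l)⁻¹) (z : ℂ) : f z = g 0 := by
  have hU : IsOpen ({0}ᶜ : Set ℂ) := isOpen_compl_singleton
  have hfa : AnalyticOnNhd ℂ f {0}ᶜ := hf.differentiableOn.analyticOnNhd hU
  have hga : AnalyticOnNhd ℂ (fun w => g w⁻¹) {0}ᶜ :=
    (hg.comp_differentiableOn (differentiableOn_inv.mono fun z hz => hz)).analyticOnNhd hU
  have hpre : IsPreconnected ({0}ᶜ : Set ℂ) :=
    (isConnected_compl_singleton_of_one_lt_rank (by simp) 0).isPreconnected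
  have hfreq : ∃ᶠ w in 𝓝[≠] (1 : ℂ), f w = g w⁻¹ := by
    have ht : Tendsto (fun x : ℝ => (x : ℂ)) (𝓝[≠] 1) (𝓝[≠] 1) := by
      refine tendsto_nhdsWithin_of_tendsto_nhds_of_eventually_within _ ?_ ?_
      · have := (Complex.continuous_ofReal.tendsto (1 : ℝ)).mono_left
          (nhdsWithin_le_nhds (s := {1}ᶜ))
        simpa using this
      · filter_upwards [self_mem_nhdsWithin] with x hx
        simpa using hx
    refine ht.frequently (Eventually.frequently ?_)
    have h0 : ∀ᶠ x : ℝ in 𝓝[≠] 1, x ≠ 0 :=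
      nhdsWithin_le_nhds (isOpen_ne.mem_nhds one_ne_zero)
    filter_upwards [h0] with x hx
    exact h (Units.mk0 x hx)
  have heq : EqOn f (fun w => g w⁻¹) {0}ᶜ :=
    hfa.eqOn_of_preconnected_of_frequently_eq hga hpre (by simp) hfreq
  obtain ⟨C₁, hC₁⟩ := (isCompact_closedBall (0 : ℂ) 1).exists_bound_of_continuousOn
    hf.continuous.continuousOn
  obtain ⟨C₂, hC₂⟩ := (isCompact_closedBall (0 : ℂ) 1).exists_bound_of_continuousOn
    hg.continuous.continuousOn
  have hb : Bornology.IsBounded (range f) := by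
    refine isBounded_iff_forall_norm_le.2 ⟨max C₁ C₂, ?_⟩
    rintro _ ⟨w, rfl⟩
    rcases le_total ‖w‖ 1 with hw | hw
    · exact (hC₁ w (by simpa using hw)).trans (le_max_left _ _)
    · have hw0 : w ≠ 0 := norm_pos_iff.1 (one_pos.trans_le hw)
      rw [heq hw0]
      refine (hC₂ w⁻¹ ?_).trans (le_max_right _ _)
      simpa using inv_le_one_of_one_le₀ hw
  have hconst : ∀ w, f w = f z := fun w => hf.apply_eq_apply_of_bounded hb w z
  have hlim : Tendsto g (𝓝[≠] 0) (𝓝 (g 0)) :=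
    hg.continuous.continuousAt.tendsto.mono_left nhdsWithin_le_nhds
  have hlim' : Tendsto g (𝓝[≠] 0) (𝓝 (f z)) := by
    refine tendsto_const_nhds.congr' ?_
    filter_upwards [self_mem_nhdsWithin] with w hw
    have := heq (x := w⁻¹) (by simpa using hw)
    simp only [inv_inv] at this
    rw [← this]
    exact (hconst _).symm
  exact tendsto_nhds_unique hlim' hlim

theorem coe_inv_SU2 (A : SU2) : ((A⁻¹ : SU2) : Mat) = (A : Mat).adjugate := by
  have h1 : ((A⁻¹ : SU2) : Mat) * (A : Mat) = 1 := by
    rw [← Submonoid.coe_mul, inv_mul_cancel]; rfl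
  have h2 : (A : Mat) * (A : Mat).adjugate = 1 := by
    rw [Matrix.mul_adjugate, (Matrix.mem_specialUnitaryGroup_iff.1 A.2).2, one_smul]
  exact left_inv_eq_right_inv h1 h2

theorem differentiable_adjugate_mul {F G : ℂ → Mat} (hF : ∀ i j, Differentiable ℂ fun z => F z i j)
    (hG : ∀ i j, Differentiable ℂ fun z => G z i j) (i j : Fin 2) :
    Differentiable ℂ fun z => ((F z).adjugate * G z) i j := by
  simp only [Matrix.adjugate_fin_two, Matrix.mul_apply, Fin.sum_univ_two]
  have := hF 0 0
  have := hF 0 1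
  have := hF 1 0
  have := hF 1 1
  have := hG 0 j
  have := hG 1 j
  fin_cases i <;> simp <;> fun_prop

/-- Uniqueness of the Birkhoff decomposition: `V'⁻¹ V = T'⁻¹ T` extends to an entire function of
`λ` and to an entire function of `1/λ`, the latter with value `I` at `0`. -/
theorem IsBirkhoff.unique {g V T V' T' : Loop} (h : IsBirkhoff g V T) (h' : IsBirkhoff g V' T') :
    V = V' ∧ T = T' := by
  obtain ⟨⟨-, c, hc⟩, ⟨-, d, hd, hd0⟩, hg⟩ := h
  obtain ⟨⟨-, c', hc'⟩, ⟨-, d', hd', hd0'⟩, hg'⟩ := h'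
  obtain ⟨F, hF, -, hFl⟩ := exists_entire_of_hasPosExpansion hc
  obtain ⟨F', hF', -, hFl'⟩ := exists_entire_of_hasPosExpansion hc'
  obtain ⟨G, hG, hG0, hGl⟩ := exists_entire_of_hasNegExpansion hd
  obtain ⟨G', hG', hG0', hGl'⟩ := exists_entire_of_hasNegExpansion hd'
  have hVT : V'⁻¹ * V = T'⁻¹ * T := by
    have : V * T⁻¹ = V' * T'⁻¹ := hg.symm.trans hg'
    rw [inv_mul_eq_iff_eq_mul, ← mul_assoc, ← this, inv_mul_cancel_right]
  have hrel : ∀ l : ℝˣ, (F' (toC l)).adjugate * F (toC l)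
      = (G' (toC l)⁻¹).adjugate * G (toC l)⁻¹ := by
    intro l
    have := congrArg (fun A : SU2 => (A : Mat)) (congrFun hVT l)
    simp only [Pi.mul_apply, Pi.inv_apply, Submonoid.coe_mul, coe_inv_SU2] at this
    rw [hFl, hFl', hGl, hGl', this]
  have hone : ∀ l : ℝˣ, (F' (toC l)).adjugate * F (toC l) = 1 := by
    intro l
    have h0 : (G' 0).adjugate * G 0 = 1 := by
      rw [hG0, hG0', hd0, hd0', Matrix.adjugate_one, mul_one]
    rw [← h0]
    ext i j
    exact eq_of_entire_of_inv (differentiable_adjugate_mul hF' hF i j)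
      (differentiable_adjugate_mul hG' hG i j) (fun l => by rw [hrel l]) (toC l)
  have hV : V'⁻¹ * V = 1 := by
    funext l
    apply Subtype.ext
    have := hone l
    rw [hFl, hFl'] at this
    simpa [coe_inv_SU2] using this
  exact ⟨(inv_mul_eq_one.1 hV).symm, (inv_mul_eq_one.1 (hVT ▸ hV)).symm⟩

end Birkhoff

/-! ### Loops attached to frames -/

section Loops

variable {D : Set ℝ} {θ : ℝ → ℝ}

/-- The loop with values `F λ`, as long as these lie in `SU(2)`. -/
def toLoop (F : ℝˣ → Mat) : Loop := by
  classical
  exact fun l => if h : F l ∈ Matrix.specialUnitaryGroup (Fin 2) ℂ then ⟨F l, h⟩ else 1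

theorem coe_toLoop {F : ℝˣ → Mat} {l : ℝˣ} (h : F l ∈ Matrix.specialUnitaryGroup (Fin 2) ℂ) :
    (toLoop F l : Mat) = F l := by
  simp [toLoop, h]

/-- The frame of `λ N(θ)` as a loop. -/
def plusLoop (θ : ℝ → ℝ) (t : ℝ) : Loop := toLoop fun l => frame θ t (toC l)

/-- The frame of `-λ⁻¹ N(θ)` as a loop. -/
def minusLoop (θ : ℝ → ℝ) (t : ℝ) : Loop := toLoop fun l => frame θ t (-(toC l)⁻¹)

theorem neg_inv_toC (l : ℝˣ) : -(toC l)⁻¹ = (((-(l : ℝ)⁻¹ : ℝ)) : ℂ) := by simp [toC]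

theorem coe_plusLoop (hD : IsBasedInterval D) (hθ : ContinuousOn θ D) {t : ℝ} (ht : t ∈ D)
    (l : ℝˣ) : (plusLoop θ t l : Mat) = frame θ t (toC l) :=
  coe_toLoop (F := fun l => frame θ t (toC l)) (frame_mem_SU2 hD hθ _ ht)

theorem coe_minusLoop (hD : IsBasedInterval D) (hθ : ContinuousOn θ D) {t : ℝ} (ht : t ∈ D)
    (l : ℝˣ) : (minusLoop θ t l : Mat) = frame θ t (-(toC l)⁻¹) :=
  coe_toLoop (F := fun l => frame θ t (-(toC l)⁻¹))
    (by simp only [neg_inv_toC]; exact frame_mem_SU2 hD hθ _ ht)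

theorem mem_loopsPlusStar_of_frame (hD : IsBasedInterval D) (hθ : ContinuousOn θ D) {t : ℝ}
    (ht : t ∈ D) {g : Loop} (hg : ∀ l, (g l : Mat) = frame θ t (toC l)) : g ∈ loopsPlusStar := by
  have he : HasPosExpansion g fun k => frameCoeff θ k t := fun l => by
    rw [hg]; exact hasSum_frame hD ht _
  refine ⟨mem_analyticLoops_of_pos (fun l => ?_) he, _, he, rfl⟩
  rw [hg, hg, toC_neg, sigma3_inv]
  exact frame_neg hD hθ _ ht

theorem mem_loopsMinusStar_of_frame (hD : IsBasedInterval D) (hθ : ContinuousOn θ D) {t : ℝ}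
    (ht : t ∈ D) {g : Loop} (hg : ∀ l, (g l : Mat) = frame θ t (-(toC l)⁻¹)) :
    g ∈ loopsMinusStar := by
  have he : HasNegExpansion g fun k => (-1 : ℂ) ^ k • frameCoeff θ k t := fun l => by
    have h := hasSum_frame (θ := θ) hD ht (-(toC l)⁻¹)
    rw [hg]
    convert h using 2 with k
    rw [smul_smul, ← mul_pow, mul_neg_one]
  refine ⟨mem_analyticLoops_of_neg (fun l => ?_) he, _, he, by simp [frameCoeff]⟩
  rw [hg, hg, toC_neg, sigma3_inv, inv_neg, neg_inv_toC, ← frame_neg hD hθ _ ht]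

theorem diagMat_mul_sigma3 (t : ℝ) : sigma3 * diagMat t * sigma3 = diagMat t := by
  ext i j
  fin_cases i <;> fin_cases j <;> simp [diagMat, sigma3, Matrix.mul_apply, Fin.sum_univ_two]

/-- Multiplication by a constant diagonal loop keeps the twist and the expansion. -/
theorem mul_Vzero_mem_loopsPlus {g : Loop} (hg : g ∈ loopsPlusStar) (α : ℝ → ℝ) (x : ℝ) :
    g * Vzero α x ∈ loopsPlus := by
  obtain ⟨⟨htw, -⟩, c, hc, -⟩ := hg
  have he : HasPosExpansion (g * Vzero α x) fun k => c k * diagMat (α x) := fun l => by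
    have h := (hc l).mul_right (diagMat (α x))
    simp only [smul_mul_assoc] at h
    exact h
  refine ⟨mem_analyticLoops_of_pos (fun l => ?_) he, _, he⟩
  have h1 := htw l
  simp only [Pi.mul_apply, Submonoid.coe_mul, Vzero, h1, sigma3_inv]
  conv_lhs => rw [← diagMat_mul_sigma3 (α x)]
  have h2 := sigma3_mul_self
  calc _ = sigma3 * (g l : Mat) * (sigma3 * sigma3) * diagMat (α x) * sigma3 := by
        simp only [mul_assoc]
    _ = _ := by rw [h2]; simp only [mul_assoc, one_mul]

end Loops

/-! ### The Lax pair of the sine-Gordon equation -/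

section LaxPair

attribute [local instance] Matrix.linftyOpNormedRing Matrix.linftyOpNormedAlgebra

variable {D D₁ D₂ : Set ℝ}

/-- The `x`-part of the Lax pair, `(i/2) [[-p, λ], [λ, p]]` with `p = φ_x`. -/
def laxX (l : ℝˣ) (p : ℝ) : Mat := (Complex.I / 2) • !![-(p : ℂ), toC l; toC l, (p : ℂ)]

/-- The `y`-part of the Lax pair, `-(i/(2λ)) [[0, e^{iφ}], [e^{-iφ}, 0]]`. -/
def laxY (l : ℝˣ) (φ : ℝ) : Mat := (-(toC l)⁻¹) • angleMat (-φ)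

theorem laxY_eq (l : ℝˣ) (φ : ℝ) :
    laxY l φ = (-(Complex.I / (2 * toC l))) •
      !![0, Complex.exp (Complex.I * φ); Complex.exp (-(Complex.I * φ)), 0] :=
  (etaMinus_eq (fun _ => φ) 0 l).symm

theorem star_laxX (l : ℝˣ) (p : ℝ) : star (laxX l p) = -laxX l p := by
  ext i j
  fin_cases i <;> fin_cases j <;> simp [laxX, Matrix.star_apply, toC, neg_div, Complex.conj_ofReal]

theorem star_laxY (l : ℝˣ) (φ : ℝ) : star (laxY l φ) = -laxY l φ := by
  rw [laxY, neg_inv_toC]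
  exact star_smul_angleMat _ _

theorem contDiff_laxX (l : ℝˣ) : ContDiff ℝ ∞ (laxX l) := by
  rw [← contDiffOn_univ, contDiffOn_mat_iff]
  have h : ContDiff ℝ ∞ fun θ : ℝ => (θ : ℂ) := Complex.ofRealCLM.contDiff
  intro i j
  rw [contDiffOn_univ]
  fin_cases i <;> fin_cases j <;> simp [laxX] <;> fun_prop

theorem contDiff_laxY (l : ℝˣ) : ContDiff ℝ ∞ (laxY l) :=
  (contDiff_angleMat.comp contDiff_neg).const_smul (-(toC l)⁻¹)

theorem hasDerivWithinAt_laxX (l : ℝˣ) {f : ℝ → ℝ} {f' t : ℝ} {S : Set ℝ}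
    (hf : HasDerivWithinAt f f' S t) :
    HasDerivWithinAt (fun s => laxX l (f s))
      ((Complex.I / 2) • !![-(f' : ℂ), 0; 0, (f' : ℂ)]) S t := by
  rw [← matHasDerivWithinAt_iff]
  have h := hf.ofReal_comp
  intro i j
  fin_cases i <;> fin_cases j <;> simp only [laxX, Matrix.smul_apply, smul_eq_mul] <;>
    simp <;> first | exact hasDerivWithinAt_const .. | skip
  · exact (h.const_mul (Complex.I / 2)).fun_neg
  · exact h.const_mul (Complex.I / 2)

theorem hasDerivWithinAt_exp_mul {f : ℝ → ℝ} {f' t : ℝ} {S : Set ℝ}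
    (hf : HasDerivWithinAt f f' S t) (c : ℂ) :
    HasDerivWithinAt (fun s => Complex.exp (c * f s)) (Complex.exp (c * f t) * (c * f')) S t :=
  (hf.ofReal_comp.const_mul c).cexp

theorem hasDerivWithinAt_laxY (l : ℝˣ) {f : ℝ → ℝ} {f' t : ℝ} {S : Set ℝ}
    (hf : HasDerivWithinAt f f' S t) :
    HasDerivWithinAt (fun s => laxY l (f s))
      ((f' / (2 * toC l)) • !![0, Complex.exp (Complex.I * f t);
        -Complex.exp (-(Complex.I * f t)), 0]) S t := by
  simp only [laxY_eq]
  rw [← matHasDerivWithinAt_iff]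
  have h1 := hasDerivWithinAt_exp_mul hf Complex.I
  have h2 := hasDerivWithinAt_exp_mul hf (-Complex.I)
  simp only [neg_mul] at h2
  have hI := Complex.I_mul_I
  intro i j
  fin_cases i <;> fin_cases j <;> simp only [Matrix.smul_apply, smul_eq_mul]
  · simpa using hasDerivWithinAt_const ..
  · refine (h1.const_mul (-(Complex.I / (2 * toC l)))).congr_deriv ?_
    change _ = (f' : ℂ) / (2 * toC l) * Complex.exp (Complex.I * f t)
    linear_combination (-(f' : ℂ) / (2 * toC l) * Complex.exp (Complex.I * f t)) * hI
  · refine (h2.const_mul (-(Complex.I / (2 * toC l)))).congr_deriv ?_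
    change _ = (f' : ℂ) / (2 * toC l) * -Complex.exp (-(Complex.I * f t))
    linear_combination ((f' : ℂ) / (2 * toC l) * Complex.exp (-(Complex.I * f t))) * hI
  · simpa using hasDerivWithinAt_const ..

/-- The zero-curvature equation `A_y - B_x = [A, B]` of the Lax pair is the sine-Gordon equation
`φ_xy = sin φ`. -/
theorem lax_zero_curvature (l : ℝˣ) (φ p : ℝ) :
    (Complex.I / 2) • !![-((Real.sin φ : ℝ) : ℂ), 0; 0, ((Real.sin φ : ℝ) : ℂ)]
      - (p / (2 * toC l)) • !![0, Complex.exp (Complex.I * φ);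
        -Complex.exp (-(Complex.I * φ)), 0]
      = laxX l p * laxY l φ - laxY l φ * laxX l p := by
  have hl := toC_ne_zero l
  have hsin : ((Real.sin φ : ℝ) : ℂ)
      = (Complex.exp (-(Complex.I * φ)) - Complex.exp (Complex.I * φ)) * Complex.I / 2 := by
    rw [Complex.ofReal_sin, Complex.sin, mul_comm Complex.I (φ : ℂ), neg_mul]
  rw [hsin, laxY_eq, laxX]
  set e := Complex.exp (Complex.I * φ)
  set e' := Complex.exp (-(Complex.I * φ))
  have hI2 : Complex.I ^ 2 = -1 := Complex.I_sq
  ext i j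
  fin_cases i <;> fin_cases j <;>
    simp <;> field_simp <;> ring_nf <;>
    simp only [hI2] <;> ring

theorem diagMat_zero : diagMat 0 = 1 := by
  ext i j
  fin_cases i <;> fin_cases j <;> simp [diagMat]

/-- The gauge transformation by `diagMat ψ` turns the potential `λ N(ψ)` into the `x`-part of the
Lax pair. -/
theorem hasDerivWithinAt_mul_diagMat (l : ℝˣ) {W : ℝ → Mat} {ψ : ℝ → ℝ} {p t : ℝ} {S : Set ℝ}
    (hW : HasDerivWithinAt W (W t * (toC l • angleMat (ψ t))) S t)
    (hψ : HasDerivWithinAt ψ p S t) :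
    HasDerivWithinAt (fun s => W s * diagMat (ψ s)) (W t * diagMat (ψ t) * laxX l p) S t := by
  have hd : HasDerivWithinAt (fun s => diagMat (ψ s))
      (diagMat (ψ t) * (Complex.I / 2) • !![-(p : ℂ), 0; 0, (p : ℂ)]) S t := by
    rw [← matHasDerivWithinAt_iff]
    have h1 := hasDerivWithinAt_exp_mul hψ (Complex.I / 2)
    have h2 := hasDerivWithinAt_exp_mul hψ (-(Complex.I / 2))
    have e1 : ∀ s : ℝ, Complex.I * s / 2 = Complex.I / 2 * s := fun s => by ring
    have e2 : ∀ s : ℝ, -(Complex.I / 2 * s) = -(Complex.I / 2) * s := fun s => by ring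
    intro i j
    fin_cases i <;> fin_cases j
    · simp only [diagMat, e1, e2]
      simpa [Matrix.mul_apply, Fin.sum_univ_two] using h2
    · simpa [diagMat, Matrix.mul_apply, Fin.sum_univ_two] using hasDerivWithinAt_const ..
    · simpa [diagMat, Matrix.mul_apply, Fin.sum_univ_two] using hasDerivWithinAt_const ..
    · simp only [diagMat, e1, e2]
      simpa [Matrix.mul_apply, Fin.sum_univ_two] using h1
  refine (hW.mul hd).congr_deriv ?_
  -- `N(ψ) diag = diag N(0)`
  have hconj : angleMat (ψ t) * diagMat (ψ t)
      = diagMat (ψ t) * ((Complex.I / 2) • !![0, 1; 1, 0]) := by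
    have h3 : Complex.exp (-(Complex.I * ψ t)) * Complex.exp (Complex.I * ψ t / 2)
        = Complex.exp (-(Complex.I * ψ t / 2)) := by
      rw [← Complex.exp_add]; congr 1; ring
    have h4 : Complex.exp (Complex.I * ψ t) * Complex.exp (-(Complex.I * ψ t / 2))
        = Complex.exp (Complex.I * ψ t / 2) := by
      rw [← Complex.exp_add]; congr 1; ring
    ext i j
    fin_cases i <;> fin_cases j <;>
      simp [angleMat, diagMat, Matrix.mul_apply, Fin.sum_univ_two]
    · linear_combination (Complex.I / 2) * h3
    · linear_combination (Complex.I / 2) * h4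
  have hsplit : laxX l p = toC l • ((Complex.I / 2) • !![0, 1; 1, 0])
      + (Complex.I / 2) • !![-(p : ℂ), 0; 0, (p : ℂ)] := by
    ext i j
    fin_cases i <;> fin_cases j <;> simp [laxX, mul_comm]
  generalize ((Complex.I / 2) • !![0, 1; 1, 0] : Mat) = X at hconj hsplit
  rw [hsplit]
  simp only [mul_add, mul_smul_comm, smul_mul_assoc, mul_assoc, hconj]

theorem contDiffOn_adjugate {X : Type*} [NormedAddCommGroup X] [NormedSpace ℝ X] {F : X → Mat}
    {S : Set X} (hF : ContDiffOn ℝ ∞ F S) : ContDiffOn ℝ ∞ (fun x => (F x).adjugate) S := by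
  rw [contDiffOn_mat_iff] at hF ⊢
  intro i j
  simp only [Matrix.adjugate_fin_two]
  fin_cases i <;> fin_cases j
  exacts [hF 1 1, (hF 0 1).neg, (hF 1 0).neg, hF 0 0]

theorem coe_mul_star_SU2 (A : SU2) : (A : Mat) * star (A : Mat) = 1 :=
  Matrix.mem_unitaryGroup_iff.1 (Matrix.mem_specialUnitaryGroup_iff.1 A.2).1

/-- Solutions of a smooth linear equation on an interval are smooth. -/
theorem contDiffOn_of_ode (hD : IsBasedInterval D) {W η : ℝ → Mat} (hη : ContDiffOn ℝ ∞ η D)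
    (hW : ∀ x ∈ D, HasDerivWithinAt W (W x * η x) D x) : ContDiffOn ℝ ∞ W D := by
  have h := contDiffOn_frame hD hD (U := fun x _ => W x) (A := fun x _ => η x) (B := fun _ _ => 0)
    (continuousOn_comp_fst fun x hx => (hW x hx).continuousWithinAt) (contDiffOn_comp_fst hη)
    contDiffOn_const (fun x hx _ _ => hW x hx)
    (fun x _ y _ => by simpa using hasDerivWithinAt_const y D (W x))
  exact h.comp (f := fun x => (x, (0 : ℝ))) (by fun_prop) fun x hx => ⟨hx, hD.zero_mem⟩

theorem contDiff_diagMat : ContDiff ℝ ∞ diagMat := by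
  rw [← contDiffOn_univ, contDiffOn_mat_iff]
  have h : ContDiff ℝ ∞ fun θ : ℝ => (θ : ℂ) := Complex.ofRealCLM.contDiff
  intro i j
  rw [contDiffOn_univ]
  fin_cases i <;> fin_cases j <;> simp [diagMat] <;> fun_prop

/-! ### The extended frame -/

/-- A solution of the potential equation for `η₊` agrees with the power series. -/
theorem IntegratesPotential.eq_frame_plus (hD : IsBasedInterval D) {α : ℝ → ℝ}
    (hα : ContinuousOn α D) {W : ℝ → Loop} (hW : IntegratesPotential (etaPlus α) D W) {t : ℝ}
    (ht : t ∈ D) (l : ℝˣ) : (W t l : Mat) = frame α t (toC l) := by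
  refine eq_of_ode (W := fun t => (W t l : Mat)) (E := fun t => frame α t (toC l))
    (η := fun t => etaPlus α t l) hD (fun t ht => matHasDerivWithinAt_iff.1 (hW.2 t ht l))
    (fun t ht => ?_) (fun t _ => ?_) ?_ ?_ ht
  · rw [etaPlus_eq]
    exact hasDerivWithinAt_frame hD hα _ ht
  · rw [etaPlus_eq]
    exact star_smul_angleMat _ _
  · simp [hW.1, frame_zero]
  · simp [frame_zero]

/-- A solution of the potential equation for `η₋` agrees with the power series. -/
theorem IntegratesPotential.eq_frame_minus (hD : IsBasedInterval D) {β : ℝ → ℝ}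
    (hβ : ContinuousOn β D) {W : ℝ → Loop} (hW : IntegratesPotential (etaMinus β) D W) {t : ℝ}
    (ht : t ∈ D) (l : ℝˣ) : (W t l : Mat) = frame (fun s => -β s) t (-(toC l)⁻¹) := by
  refine eq_of_ode (W := fun t => (W t l : Mat))
    (E := fun t => frame (fun s => -β s) t (-(toC l)⁻¹))
    (η := fun t => etaMinus β t l) hD (fun t ht => matHasDerivWithinAt_iff.1 (hW.2 t ht l))
    (fun t ht => ?_) (fun t _ => ?_) ?_ ?_ ht
  · rw [etaMinus_eq]
    exact hasDerivWithinAt_frame hD hβ.neg _ ht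
  · rw [etaMinus_eq, neg_inv_toC]
    exact star_smul_angleMat _ _
  · simp [hW.1, frame_zero]
  · simp [frame_zero]

theorem integratesPotential_plusLoop (hD : IsBasedInterval D) {α : ℝ → ℝ}
    (hα : ContinuousOn α D) : IntegratesPotential (etaPlus α) D (plusLoop α) := by
  refine ⟨?_, fun t ht l => matHasDerivWithinAt_iff.2 ?_⟩
  · funext l
    apply Subtype.ext
    rw [coe_plusLoop hD hα hD.zero_mem, frame_zero]
    rfl
  · rw [coe_plusLoop hD hα ht, etaPlus_eq]
    exact (hasDerivWithinAt_frame hD hα _ ht).congr (fun s hs => coe_plusLoop hD hα hs l)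
      (coe_plusLoop hD hα ht l)

theorem integratesPotential_minusLoop (hD : IsBasedInterval D) {β : ℝ → ℝ}
    (hβ : ContinuousOn β D) :
    IntegratesPotential (etaMinus β) D (minusLoop fun s => -β s) := by
  have hβ' : ContinuousOn (fun s => -β s) D := hβ.neg
  refine ⟨?_, fun t ht l => matHasDerivWithinAt_iff.2 ?_⟩
  · funext l
    apply Subtype.ext
    rw [coe_minusLoop hD hβ' hD.zero_mem, frame_zero]
    rfl
  · rw [coe_minusLoop hD hβ' ht, etaMinus_eq]
    exact (hasDerivWithinAt_frame hD hβ' _ ht).congr (fun s hs => coe_minusLoop hD hβ' hs l)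
      (coe_minusLoop hD hβ' ht l)

/-- For a solution `φ` of the sine-Gordon equation with the prescribed boundary values, the frame of
the Lax pair is `U = U₋V = U₊V₀T`, where `V(·, y)` and `T(x, ·)` are themselves frames of
potentials, in which `α` and `β` are replaced by `φ(·, y) - β(y)` and `φ(x, ·)`. -/
theorem exists_extendedFrame (h₁ : IsBasedInterval D₁) (h₂ : IsBasedInterval D₂) {α β : ℝ → ℝ}
    (hα₀ : α 0 = 0) {φ φx : ℝ → ℝ → ℝ}
    (hφ : ContDiffOn ℝ ∞ (fun p : ℝ × ℝ => φ p.1 p.2) (D₁ ×ˢ D₂))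
    (hφx : ContDiffOn ℝ ∞ (fun p : ℝ × ℝ => φx p.1 p.2) (D₁ ×ˢ D₂))
    (hd : ∀ x ∈ D₁, ∀ y ∈ D₂, HasDerivWithinAt (fun s => φ s y) (φx x y) D₁ x)
    (hsg : ∀ x ∈ D₁, ∀ y ∈ D₂, HasDerivWithinAt (fun t => φx x t) (Real.sin (φ x y)) D₂ y)
    (hφ₁ : ∀ x ∈ D₁, φ x 0 = α x + β 0) (hφ₂ : ∀ y ∈ D₂, φ 0 y = β y) {UX UY : ℝ → Loop}
    (hX : IntegratesPotential (etaPlus α) D₁ UX) (hY : IntegratesPotential (etaMinus β) D₂ UY) :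
    ∃ (V T : ℝ → ℝ → Loop) (Φ : ℝˣ → ℝ → ℝ → Mat),
      (∀ x ∈ D₁, ∀ y ∈ D₂, V x y ∈ loopsPlus ∧ T x y ∈ loopsMinusStar) ∧
      ∀ l : ℝˣ, ContDiffOn ℝ ∞ (fun p : ℝ × ℝ => Φ l p.1 p.2) (D₁ ×ˢ D₂) ∧
        (∀ x ∈ D₁, ∀ y ∈ D₂,
          HasDerivWithinAt (fun s => Φ l s y) (Φ l x y * laxX l (φx x y)) D₁ x) ∧
        (∀ x ∈ D₁, ∀ y ∈ D₂,
          HasDerivWithinAt (fun t => Φ l x t) (Φ l x y * laxY l (φ x y)) D₂ y) ∧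
        ∀ x ∈ D₁, ∀ y ∈ D₂, Φ l x y = ((UY y * V x y) l : SU2) ∧
          Φ l x y = ((UX x * Vzero α x * T x y) l : SU2) := by
  have hφc := hφ.continuousOn
  set ψ : ℝ → ℝ → ℝ := fun y x => φ x y - β y with hψ
  have hψc : ∀ y ∈ D₂, ContinuousOn (ψ y) D₁ := fun y hy =>
    (continuousOn_left hφc hy).sub continuousOn_const
  have hφn : ∀ x ∈ D₁, ContinuousOn (φ x) D₂ := fun x hx => continuousOn_right hφc hx
  have hXd : ∀ (l : ℝˣ), ∀ x ∈ D₁, HasDerivWithinAt (fun s => (UX s l : Mat) * diagMat (α s))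
      ((UX x l : Mat) * diagMat (α x) * laxX l (φx x 0)) D₁ x := by
    intro l x hx
    have h := matHasDerivWithinAt_iff.1 (hX.2 x hx l)
    rw [etaPlus_eq] at h
    have hαd : HasDerivWithinAt α (φx x 0) D₁ x := by
      have h3 := (hd x hx 0 h₂.zero_mem).sub_const (β 0)
      exact h3.congr (fun s hs => by rw [hφ₁ s hs]; ring) (by rw [hφ₁ x hx]; ring)
    exact hasDerivWithinAt_mul_diagMat l h hαd
  have hYd : ∀ (l : ℝˣ), ∀ y ∈ D₂, HasDerivWithinAt (fun t => (UY t l : Mat))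
      ((UY y l : Mat) * laxY l (φ 0 y)) D₂ y := by
    intro l y hy
    have h := matHasDerivWithinAt_iff.1 (hY.2 y hy l)
    rwa [etaMinus_eq, ← hφ₂ y hy] at h
  have hA : ∀ l : ℝˣ, ContDiffOn ℝ ∞ (fun p : ℝ × ℝ => laxX l (φx p.1 p.2)) (D₁ ×ˢ D₂) :=
    fun l => (contDiff_laxX l).comp_contDiffOn hφx
  have hB : ∀ l : ℝˣ, ContDiffOn ℝ ∞ (fun p : ℝ × ℝ => laxY l (φ p.1 p.2)) (D₁ ×ˢ D₂) :=
    fun l => (contDiff_laxY l).comp_contDiffOn hφ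
  have hAy : ∀ l : ℝˣ, ∀ x ∈ D₁, ∀ y ∈ D₂, HasDerivWithinAt (fun t => laxX l (φx x t))
      ((Complex.I / 2) •
        !![-((Real.sin (φ x y) : ℝ) : ℂ), 0; 0, ((Real.sin (φ x y) : ℝ) : ℂ)]) D₂ y :=
    fun l x hx y hy => hasDerivWithinAt_laxX l (hsg x hx y hy)
  have hAyc : ContinuousOn (fun p : ℝ × ℝ => (Complex.I / 2) •
      !![-((Real.sin (φ p.1 p.2) : ℝ) : ℂ), 0; 0, ((Real.sin (φ p.1 p.2) : ℝ) : ℂ)])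
      (D₁ ×ˢ D₂) := by
    have hc : ∀ r : ℝ, (Complex.I / 2) • (!![-(r : ℂ), 0; 0, (r : ℂ)] : Mat)
        = laxX 1 r - laxX 1 0 := by
      intro r
      ext i j
      fin_cases i <;> fin_cases j <;> simp [laxX]
    exact (((contDiff_laxX 1).continuous.comp Real.continuous_sin).comp_continuousOn hφc |>.sub
      continuousOn_const).congr fun p _ => hc _
  have hfl : ∀ l : ℝˣ, ∃ U : ℝ → ℝ → Mat, ContinuousOn (fun p : ℝ × ℝ => U p.1 p.2) (D₁ ×ˢ D₂) ∧
      (∀ x ∈ D₁, ∀ y ∈ D₂, HasDerivWithinAt (fun s => U s y) (U x y * laxX l (φx x y)) D₁ x) ∧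
      (∀ x ∈ D₁, ∀ y ∈ D₂, HasDerivWithinAt (fun t => U x t) (U x y * laxY l (φ x y)) D₂ y) ∧
      (∀ x ∈ D₁, U x 0 = (UX x l : Mat) * diagMat (α x)) ∧ ∀ y ∈ D₂, U 0 y = (UY y l : Mat) :=
    fun l => exists_flat_frame h₁ h₂ (A := fun x y => laxX l (φx x y))
      (B := fun x y => laxY l (φ x y)) (hA l).continuousOn (hB l).continuousOn hAyc (hAy l)
      (fun x hx y hy => hasDerivWithinAt_laxY l (hd x hx y hy))
      (fun x _ y _ => lax_zero_curvature l (φ x y) (φx x y)) (hXd l) (hYd l)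
      (by simp [hX.1, hα₀, diagMat_zero]) (by simp [hY.1])
  choose Φ hΦc hΦx hΦy hΦ1 hΦ2 using hfl
  have hT : ∀ x ∈ D₁, IntegratesPotential (etaMinus (φ x)) D₂ (minusLoop fun s => -φ x s) :=
    fun x hx => integratesPotential_minusLoop h₂ (hφn x hx)
  have hV : ∀ y ∈ D₂, IntegratesPotential (etaPlus (ψ y)) D₁ (plusLoop (ψ y)) :=
    fun y hy => integratesPotential_plusLoop h₁ (hψc y hy)
  refine ⟨fun x y => plusLoop (ψ y) x * Vzero (ψ y) x, fun x y => minusLoop (fun s => -φ x s) y, Φ,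
    fun x hx y hy => ⟨mul_Vzero_mem_loopsPlus (mem_loopsPlusStar_of_frame h₁ (hψc y hy) hx
      (coe_plusLoop h₁ (hψc y hy) hx)) _ _, mem_loopsMinusStar_of_frame h₂ (hφn x hx).neg hy
      (coe_minusLoop h₂ (hφn x hx).neg hy)⟩, fun l => ⟨contDiffOn_frame h₁ h₂ (hΦc l) (hA l) (hB l)
      (hΦx l) (hΦy l), hΦx l, hΦy l, fun x hx y hy => ⟨?_, ?_⟩⟩⟩
  · refine eq_of_ode (W := fun s => Φ l s y)
      (E := fun s => (((UY y * (plusLoop (ψ y) s * Vzero (ψ y) s)) l : SU2) : Mat))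
      (η := fun s => laxX l (φx s y)) h₁ (fun s hs => hΦx l s hs y hy) (fun s hs => ?_)
      (fun s _ => star_laxX l _) ?_ (coe_mul_star_SU2 _) hx
    · have h := matHasDerivWithinAt_iff.1 ((hV y hy).2 s hs l)
      rw [etaPlus_eq] at h
      have h3 := (hasDerivWithinAt_mul_diagMat l h ((hd s hs y hy).sub_const (β y))).const_mul
        (UY y l : Mat)
      rw [← mul_assoc] at h3
      exact h3
    · have h0 : ψ y 0 = 0 := by simp [hψ, hφ₂ y hy]
      simp [hΦ2 l y hy, (hV y hy).1, Vzero, h0, diagMat_zero]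
  · refine eq_of_ode (W := fun t => Φ l x t)
      (E := fun t => (((UX x * Vzero α x * minusLoop (fun s => -φ x s) t) l : SU2) : Mat))
      (η := fun t => laxY l (φ x t)) h₂ (fun t ht => hΦy l x hx t ht) (fun t ht => ?_)
      (fun t _ => star_laxY l _) ?_ (coe_mul_star_SU2 _) hy
    · have h := matHasDerivWithinAt_iff.1 ((hT x hx).2 t ht l)
      rw [etaMinus_eq] at h
      have h3 := h.const_mul ((UX x l : Mat) * diagMat (α x))
      rw [← mul_assoc] at h3
      exact h3
    · simp [hΦ1 l x hx, (hT x hx).1, Vzero]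

theorem smoothLoopMap_of_coe {V : ℝ → ℝ → Loop} {F : ℝˣ → ℝ × ℝ → Mat} {S : Set (ℝ × ℝ)}
    (hF : ∀ l, ContDiffOn ℝ ∞ (F l) S) (h : ∀ l, ∀ p ∈ S, (V p.1 p.2 l : Mat) = F l p) :
    SmoothLoopMap V S := by
  intro l
  exact contDiffOn_mat_iff.1 ((hF l).congr fun p hp => h l p hp)

/-- The Birkhoff decompositions of `U₋⁻¹ U₊ V₀` exist, are unique and smooth, and produce a solution
of the Lax system. -/
theorem lax_of_birkhoff (h₁ : IsBasedInterval D₁) (h₂ : IsBasedInterval D₂) {α β : ℝ → ℝ}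
    (hα : ContDiffOn ℝ ∞ α D₁) (hβ : ContDiffOn ℝ ∞ β D₂) (hα₀ : α 0 = 0) {UX UY : ℝ → Loop}
    (hX : IntegratesPotential (etaPlus α) D₁ UX) (hY : IntegratesPotential (etaMinus β) D₂ UY) :
    (∀ x ∈ D₁, ∀ y ∈ D₂, ∃! p : Loop × Loop,
      IsBirkhoff ((UY y)⁻¹ * UX x * Vzero α x) p.1 p.2) ∧
    ∀ Vp Tm U : ℝ → ℝ → Loop,
      (∀ x ∈ D₁, ∀ y ∈ D₂,
        IsBirkhoff ((UY y)⁻¹ * UX x * Vzero α x) (Vp x y) (Tm x y)) →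
      (∀ x ∈ D₁, ∀ y ∈ D₂, U x y = UX x * Vzero α x * Tm x y) →
      SmoothLoopMap Vp (D₁ ×ˢ D₂) ∧ SmoothLoopMap Tm (D₁ ×ˢ D₂) ∧ SmoothLoopMap U (D₁ ×ˢ D₂) ∧
      (∀ x ∈ D₁, ∀ y ∈ D₂, U x y = UY y * Vp x y) ∧ U 0 0 = 1 ∧
      ∃ φ : ℝ → ℝ → ℝ, ContDiffOn ℝ ∞ (fun p : ℝ × ℝ => φ p.1 p.2) (D₁ ×ˢ D₂) ∧
        LaxSystem D₁ D₂ U φ ∧ (∀ x ∈ D₁, φ x 0 = α x + β 0) ∧ (∀ y ∈ D₂, φ 0 y = β y) := by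
  obtain ⟨φ, φx, hφ, hφx, hd, hsg, hφ₁, hφ₂⟩ := exists_sineGordon h₁ h₂ hα hβ hα₀
  obtain ⟨V, T, Φ, hVT, hΦ⟩ := exists_extendedFrame h₁ h₂ hα₀ hφ hφx hd hsg hφ₁ hφ₂ hX hY
  have heq : ∀ x ∈ D₁, ∀ y ∈ D₂, UY y * V x y = UX x * Vzero α x * T x y := by
    intro x hx y hy
    funext l
    obtain ⟨-, -, -, h⟩ := hΦ l
    exact Subtype.ext ((h x hx y hy).1.symm.trans (h x hx y hy).2)
  have hB : ∀ x ∈ D₁, ∀ y ∈ D₂,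
      IsBirkhoff ((UY y)⁻¹ * UX x * Vzero α x) (V x y) (T x y) := by
    intro x hx y hy
    refine ⟨(hVT x hx y hy).1, (hVT x hx y hy).2, ?_⟩
    rw [eq_mul_inv_iff_mul_eq, mul_assoc, mul_assoc, inv_mul_eq_iff_eq_mul, heq x hx y hy,
      mul_assoc]
  refine ⟨fun x hx y hy => ⟨(V x y, T x y), hB x hx y hy, fun q hq => ?_⟩,
    fun Vp Tm U hBirk hU => ?_⟩
  · exact Prod.ext (hq.unique (hB x hx y hy)).1 (hq.unique (hB x hx y hy)).2
  have hTm : ∀ x ∈ D₁, ∀ y ∈ D₂, Tm x y = T x y := fun x hx y hy =>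
    ((hBirk x hx y hy).unique (hB x hx y hy)).2
  have hVp : ∀ x ∈ D₁, ∀ y ∈ D₂, Vp x y = V x y := fun x hx y hy =>
    ((hBirk x hx y hy).unique (hB x hx y hy)).1
  have hUV : ∀ x ∈ D₁, ∀ y ∈ D₂, U x y = UY y * Vp x y := fun x hx y hy => by
    rw [hU x hx y hy, hTm x hx y hy, hVp x hx y hy, heq x hx y hy]
  have hUΦ : ∀ l, ∀ x ∈ D₁, ∀ y ∈ D₂, (U x y l : Mat) = Φ l x y := fun l x hx y hy => by
    rw [hU x hx y hy, hTm x hx y hy, ((hΦ l).2.2.2 x hx y hy).2]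
  have hXs : ∀ l, ContDiffOn ℝ ∞ (fun x => (UX x l : Mat)) D₁ := fun l =>
    contDiffOn_of_ode h₁ (η := fun x => etaPlus α x l)
      (by
        simp only [etaPlus_eq]
        exact (contDiff_angleMat.comp_contDiffOn hα).const_smul (toC l))
      fun x hx => matHasDerivWithinAt_iff.1 (hX.2 x hx l)
  have hYs : ∀ l, ContDiffOn ℝ ∞ (fun y => (UY y l : Mat)) D₂ := fun l =>
    contDiffOn_of_ode h₂ (η := fun y => etaMinus β y l)
      (by
        simp only [etaMinus_eq]
        exact (contDiff_angleMat.comp_contDiffOn hβ.neg).const_smul (-(toC l)⁻¹))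
      fun y hy => matHasDerivWithinAt_iff.1 (hY.2 y hy l)
  refine ⟨?_, ?_, ?_, hUV, ?_, φ, hφ, ?_, hφ₁, hφ₂⟩
  · refine smoothLoopMap_of_coe (F := fun l p => (UY p.2 l : Mat).adjugate * Φ l p.1 p.2)
      (fun l => (contDiffOn_adjugate (contDiffOn_comp_snd (hYs l))).mul (hΦ l).1)
      fun l p hp => ?_
    have h : Vp p.1 p.2 l = (UY p.2 l)⁻¹ * U p.1 p.2 l := by
      rw [hUV p.1 hp.1 p.2 hp.2, Pi.mul_apply, inv_mul_cancel_left]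
    rw [h, Submonoid.coe_mul, coe_inv_SU2, hUΦ l p.1 hp.1 p.2 hp.2]
  · refine smoothLoopMap_of_coe
      (F := fun l p => ((UX p.1 l : Mat) * diagMat (α p.1)).adjugate * Φ l p.1 p.2)
      (fun l => (contDiffOn_adjugate (contDiffOn_comp_fst ((hXs l).mul
        (contDiff_diagMat.comp_contDiffOn hα)))).mul (hΦ l).1) fun l p hp => ?_
    have h : Tm p.1 p.2 l = (UX p.1 l * Vzero α p.1 l)⁻¹ * U p.1 p.2 l := by
      rw [hU p.1 hp.1 p.2 hp.2, Pi.mul_apply, Pi.mul_apply, inv_mul_cancel_left]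
    rw [h, Submonoid.coe_mul, coe_inv_SU2, hUΦ l p.1 hp.1 p.2 hp.2]
    rfl
  · exact smoothLoopMap_of_coe (F := fun l p => Φ l p.1 p.2) (fun l => (hΦ l).1)
      fun l p hp => hUΦ l p.1 hp.1 p.2 hp.2
  · -- at the origin `I = I · I⁻¹` is the Birkhoff decomposition
    have hV0 : Vzero α 0 = 1 := by
      funext l
      exact Subtype.ext (by simp [Vzero, hα₀, diagMat_zero])
    have hB0 := hBirk 0 h₁.zero_mem 0 h₂.zero_mem
    rw [hX.1, hY.1, hV0] at hB0
    have he : HasPosExpansion 1 fun k => if k = 0 then 1 else 0 := fun l => by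
      have h := hasSum_frame (θ := fun _ => 0) h₁ h₁.zero_mem (toC l)
      simp only [frame_zero, frameCoeff_zero_right] at h
      exact h
    have hplus : (1 : Loop) ∈ loopsPlusStar :=
      mem_loopsPlusStar_of_frame (θ := fun _ => 0) h₁ continuousOn_const h₁.zero_mem
        fun l => by rw [frame_zero]; rfl
    have hminus : (1 : Loop) ∈ loopsMinusStar :=
      mem_loopsMinusStar_of_frame (θ := fun _ => 0) h₁ continuousOn_const h₁.zero_mem
        fun l => by rw [frame_zero]; rfl
    have hT0 := (hB0.unique (V' := 1) (T' := 1)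
      ⟨⟨hplus.1, _, he⟩, hminus, by simp⟩).2
    rw [hU 0 h₁.zero_mem 0 h₂.zero_mem, hX.1, hV0, hT0, mul_one, mul_one]
  · intro x hx y hy l
    obtain ⟨-, hΦx, hΦy, -⟩ := hΦ l
    have hφd : derivWithin (fun s => φ s y) D₁ x = φx x y :=
      (hd x hx y hy).derivWithin (h₁.uniqueDiffOn x hx)
    have hΦx' := (hΦx x hx y hy).congr (fun s hs => hUΦ l s hs y hy) (hUΦ l x hx y hy)
    have hΦy' := (hΦy x hx y hy).congr (fun t ht => hUΦ l x hx t ht) (hUΦ l x hx y hy)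
    rw [← hUΦ l x hx y hy] at hΦx' hΦy'
    rw [laxX, mul_smul_comm] at hΦx'
    rw [laxY_eq, mul_smul_comm] at hΦy'
    rw [hφd]
    exact ⟨matHasDerivWithinAt_iff.2 hΦx', matHasDerivWithinAt_iff.2 hΦy'⟩

end LaxPair

end PSLoop

end

theorem mainTheorem1 (D₁ D₂ : Set ℝ)
    (hD₁ : D₁.OrdConnected) (hD₂ : D₂.OrdConnected)
    (hD₁' : D₁.Nontrivial) (hD₂' : D₂.Nontrivial)
    (h₁ : (0 : ℝ) ∈ D₁) (h₂ : (0 : ℝ) ∈ D₂)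
    (α β : ℝ → ℝ) (hα : ContDiffOn ℝ ∞ α D₁) (hβ : ContDiffOn ℝ ∞ β D₂) (hα₀ : α 0 = 0) :
    (∃ UX UY : ℝ → PSLoop.Loop,
      PSLoop.IntegratesPotential (PSLoop.etaPlus α) D₁ UX ∧
      PSLoop.IntegratesPotential (PSLoop.etaMinus β) D₂ UY) ∧
    ∀ UX UY : ℝ → PSLoop.Loop,
      PSLoop.IntegratesPotential (PSLoop.etaPlus α) D₁ UX →
      PSLoop.IntegratesPotential (PSLoop.etaMinus β) D₂ UY →
      (∀ x ∈ D₁, UX x ∈ PSLoop.loopsPlusStar) ∧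
      (∀ y ∈ D₂, UY y ∈ PSLoop.loopsMinusStar) ∧
      (∀ x ∈ D₁, ∀ y ∈ D₂, ∃! p : PSLoop.Loop × PSLoop.Loop,
        PSLoop.IsBirkhoff ((UY y)⁻¹ * UX x * PSLoop.Vzero α x) p.1 p.2) ∧
      ∀ Vp Tm U : ℝ → ℝ → PSLoop.Loop,
        (∀ x ∈ D₁, ∀ y ∈ D₂,
          PSLoop.IsBirkhoff ((UY y)⁻¹ * UX x * PSLoop.Vzero α x) (Vp x y) (Tm x y)) →
        (∀ x ∈ D₁, ∀ y ∈ D₂, U x y = UX x * PSLoop.Vzero α x * Tm x y) →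
        PSLoop.SmoothLoopMap Vp (D₁ ×ˢ D₂) ∧
        PSLoop.SmoothLoopMap Tm (D₁ ×ˢ D₂) ∧
        PSLoop.SmoothLoopMap U (D₁ ×ˢ D₂) ∧
        (∀ x ∈ D₁, ∀ y ∈ D₂, U x y = UY y * Vp x y) ∧
        U 0 0 = 1 ∧
        ∃ φ : ℝ → ℝ → ℝ,
          ContDiffOn ℝ ∞ (fun p : ℝ × ℝ => φ p.1 p.2) (D₁ ×ˢ D₂) ∧
          PSLoop.LaxSystem D₁ D₂ U φ ∧
          (∀ x ∈ D₁, φ x 0 = α x + β 0) ∧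
          (∀ y ∈ D₂, φ 0 y = β y) := by
  have hI₁ : PSLoop.IsBasedInterval D₁ := ⟨hD₁, hD₁', h₁⟩
  have hI₂ : PSLoop.IsBasedInterval D₂ := ⟨hD₂, hD₂', h₂⟩
  have hα' : ContinuousOn α D₁ := hα.continuousOn
  have hβ' : ContinuousOn β D₂ := hβ.continuousOn
  refine ⟨⟨_, _, PSLoop.integratesPotential_plusLoop hI₁ hα',
    PSLoop.integratesPotential_minusLoop hI₂ hβ'⟩, fun UX UY hX hY => ⟨fun x hx => ?_,
    fun y hy => ?_, PSLoop.lax_of_birkhoff hI₁ hI₂ hα hβ hα₀ hX hY⟩⟩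
  · exact PSLoop.mem_loopsPlusStar_of_frame hI₁ hα' hx (hX.eq_frame_plus hI₁ hα' hx)
  · exact PSLoop.mem_loopsMinusStar_of_frame hI₂ hβ'.neg hy (hY.eq_frame_minus hI₂ hβ' hy)
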